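/- Let $d\ge 1$ be a fixed integer. For every integer $b>d$ let $$I(b,d,2)=\sum_{m}\frac1m ,$$ where $m$ runs over the positive integers whose base-$b$ representation contains the digit $d$ exactly twice; this series converges. Then $I(b,d,2)-b\log b$ has, as $b\to\infty$ with $d$ fixed, an asymptotic expansion to all orders in inverse powers of $b$, starting at $b^{-3}$: there are real numbers $a_1(d),a_2(d),\dots$ such that for every $N\ge 0$ $$I(b,d,2)=b\log b+\sum_{n=1}^{N}\frac{a_n(d)}{b^{n+2}}+O(b^{-N-3})\qquad(b\to\infty),$$ the implied constant depending on $d$ and $N$. The first five coefficients (so that the case $N=5$ has error $O(b^{-8})$) are \begin{align*} a_1(d)&=\frac{d+\frac12}{d^2},\\ a_2(d)&=-\frac{d+\frac12}{d^2(d+1)},\\ a_3(d)&=\left(d+\tfrac12\right)\zeta(2)-\frac{30d^3+70d^2+47d+10}{12d^3(d+1)^2},\\ a_4(d)&=-(2d+1)d\,\zeta(3)+(2d+1)\zeta(2)-\frac{12d^6-60d^5-258d^4-342d^3-212d^2-61d-6}{12d^4(d+1)^3},\\ a_5(d)&=3\left(d+\tfrac12\right)d^2\zeta(4)-\left(d+\tfrac12\right)(6d+1)\zeta(3)\\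 &\quad-\frac{60d^7+240d^6+440d^5+561d^4+465d^3+219d^2+54d+6}{12d^5(d+1)^3}, \end{align*} where $\zeta$ is the Riemann zeta function. -/

import Mathlib

open Filter Asymptotics

/-- The positive integers whose base-`b` representation contains the digit `d`
exactly `k` times. -/
def irwinSet (b d k : ℕ) : Set ℕ :=
  {m | 0 < m ∧ (Nat.digits b m).count d = k}

/-- The Irwin harmonic sum: the sum of `1/m` over the positive integers `m` having exactly `k`
digits equal to `d` in base `b`. -/
noncomputable def irwinSum (b d k : ℕ) : ℝ :=
  ∑' m : irwinSet b d k, 1 / ((m : ℕ) : ℝ)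

/-- The value of the Riemann zeta function at an integer `n ≥ 2`, as a real number. -/
noncomputable def zetaReal (n : ℕ) : ℝ := (riemannZeta (n : ℂ)).re

/-! For fixed `k`, let μ_k be the discrete measure on [0,1) that puts mass b^(-l) at X/b^l for every
string X of l digits (leading zeros allowed), k of which are d. `stringSum b d k` is integration
against μ_k. An integer with l + 2 digits is n b^l + X with n in [b, b^2), and 1/(n b^l + X) =
b^(-l)/(n + X/b^l). Hence I(b,d,2) is the sum over n of ∫ dμ_k(x)/(n + x), where k is 2 minus the
number of digits d in n (`irwinSum_two_eq`).

Each μ_k with k ≥ 0 has total mass b and is close to b times Lebesgue measure. The Lebesgue part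
contributes b log((n+1)/n), which telescopes over n to b log b. The deviation is found by expanding
1/(n + x) in powers of x/n: the order m term pairs the excess moment of μ_k with n^(-m-1). Since n ≥
b, higher orders cost powers of b, so finitely many moments give any prescribed accuracy
(`abs_irwinSum_sub_le`).

Two ingredients remain. Splitting off the first digit makes μ_k self-similar, so the excess moments
obey a recursion that is triangular in m, with a source coming from k - 1 (`excessMoment_rec_inv`).
It starts at k = -1, where the measure is zero, and every further digit d gains a factor b^(-2)
(`invPowO_excessMoment`). The sums of n^(-s), sorted by the digits of n, reduce to tails of zeta
series and, when the last digit is d, to zeta values obtained by expanding (1 + d/(ab))^(-s)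
(`colSum_approx`). All of these have expansions in 1/b, which proves existence of the full
expansion.

For the explicit coefficients, moments of order m ≥ 5 contribute O(b^(-8)) (`invPowO_momentTerm`),
so only m = 1, 2, 3, 4 need to be computed, each to a few terms. Uniqueness of asymptotic
coefficients identifies the two expansions. -/

/-! ### A self-similar functional on functions on the unit interval -/

/-- The contraction `x ↦ (a + x) / b`, acting on functions. -/
noncomputable def digitPull (b a : ℕ) (f : ℝ → ℝ) : ℝ → ℝ := fun x => f ((a + x) / b)

/-- The sum of `f (X / b ^ l) / b ^ l` over the strings `X` of `l` digits, `k` of which are `d`. -/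
noncomputable def levelSum (b d : ℕ) : ℕ → ℤ → (ℝ → ℝ) → ℝ
  | 0, k, f => if k = 0 then f 0 else 0
  | l + 1, k, f =>
      (∑ a ∈ Finset.range b, levelSum b d l (k - if a = d then 1 else 0) (digitPull b a f)) / b

/-- The sum of `levelSum` over all levels. -/
noncomputable def stringSum (b d : ℕ) (k : ℤ) (f : ℝ → ℝ) : ℝ := ∑' l, levelSum b d l k f

/-- `f` is bounded by `C` on the unit interval. -/
def UnitBound (f : ℝ → ℝ) (C : ℝ) : Prop := ∀ x ∈ Set.Icc (0 : ℝ) 1, |f x| ≤ C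

lemma UnitBound.digitPull {f : ℝ → ℝ} {C : ℝ} (h : UnitBound f C) {b a : ℕ} (ha : a < b) :
    UnitBound (digitPull b a f) C := by
  intro x hx
  have hb : (0 : ℝ) < b := by exact_mod_cast (Nat.zero_le a).trans_lt ha
  have hab : (a : ℝ) + 1 ≤ b := by exact_mod_cast ha
  refine h _ ⟨div_nonneg (add_nonneg (Nat.cast_nonneg a) hx.1) hb.le, ?_⟩
  rw [div_le_one hb]
  linarith [hx.2]

lemma levelSum_sum {ι : Type*} (b d : ℕ) (s : Finset ι) (c : ι → ℝ) (f : ι → ℝ → ℝ) (l : ℕ) :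
    ∀ k : ℤ, levelSum b d l k (fun x => ∑ i ∈ s, c i * f i x)
      = ∑ i ∈ s, c i * levelSum b d l k (f i) := by
  induction l generalizing f with
  | zero => intro k; by_cases hk : k = 0 <;> simp [levelSum, hk]
  | succ l ih =>
    intro k
    simp only [levelSum]
    have h : ∀ a, digitPull b a (fun x => ∑ i ∈ s, c i * f i x)
        = fun x => ∑ i ∈ s, c i * digitPull b a (f i) x := fun a => rfl
    simp only [h, ih, mul_div_assoc', ← Finset.sum_div, Finset.mul_sum]
    rw [Finset.sum_comm]

/-- The index is an integer so that removing a digit d is a true subtraction; no string has a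
negative number of digits d. -/
lemma levelSum_neg_index (b d l : ℕ) : ∀ (k : ℤ) (f : ℝ → ℝ), k < 0 → levelSum b d l k f = 0 := by
  induction l with
  | zero => intro k f hk; simp [levelSum, hk.ne]
  | succ l ih =>
    intro k f hk
    simp only [levelSum]
    rw [Finset.sum_eq_zero, zero_div]
    intro a _
    apply ih
    split_ifs <;> omega

/-- The functional is positive and the digit contractions preserve [0,1], so every convergence
question reduces to the constant function 1. -/
lemma abs_levelSum_le (b d l : ℕ) {C : ℝ} : ∀ (k : ℤ) (f : ℝ → ℝ), UnitBound f C →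
    |levelSum b d l k f| ≤ C * levelSum b d l k (fun _ => 1) := by
  induction l with
  | zero =>
    intro k f h
    by_cases hk : k = 0
    · simpa [levelSum, hk] using h 0 (by simp)
    · simp [levelSum, hk]
  | succ l ih =>
    intro k f h
    simp only [levelSum]
    rw [abs_div, Nat.abs_cast, mul_div_assoc', Finset.mul_sum]
    gcongr
    refine (Finset.abs_sum_le_sum_abs _ _).trans (Finset.sum_le_sum fun a ha => ?_)
    exact ih _ _ (h.digitPull (Finset.mem_range.1 ha))

lemma levelSum_one_nonneg (b d l : ℕ) (k : ℤ) : 0 ≤ levelSum b d l k (fun _ => 1) := by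
  have := abs_levelSum_le b d l (C := 1) k (fun _ => 1) (fun x _ => by simp)
  simpa using (abs_nonneg _).trans this

/-- Only the digit d lowers the index, so it is separated from all the others. -/
lemma sum_range_digit {b d : ℕ} (hdb : d < b) (g : ℕ → ℝ) (x : ℤ → ℝ) (k : ℤ) :
    ∑ a ∈ Finset.range b, g a * x (k - if a = d then 1 else 0)
      = (∑ a ∈ Finset.range b, g a - g d) * x k + g d * x (k - 1) := by
  rw [← Finset.add_sum_erase _ _ (Finset.mem_range.2 hdb),
    ← Finset.add_sum_erase _ g (Finset.mem_range.2 hdb), add_sub_cancel_left, Finset.sum_mul,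
    add_comm, if_pos rfl]
  congr 1
  refine Finset.sum_congr rfl fun a ha => ?_
  rw [if_neg (Finset.ne_of_mem_erase ha), sub_zero]

lemma levelSum_one_succ {b d : ℕ} (hdb : d < b) (l : ℕ) (k : ℤ) :
    levelSum b d (l + 1) k (fun _ => 1)
      = (1 - 1 / (b : ℝ)) * levelSum b d l k (fun _ => 1)
        + 1 / (b : ℝ) * levelSum b d l (k - 1) (fun _ => 1) := by
  have hb : (b : ℝ) ≠ 0 := by
    have : b ≠ 0 := by omega
    exact_mod_cast this
  have h := sum_range_digit hdb (fun _ => 1) (fun k => levelSum b d l k (fun _ => 1)) k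
  simp only [one_mul, Finset.sum_const, Finset.card_range, nsmul_eq_mul, mul_one] at h
  have e : ∀ a, digitPull b a (fun _ => 1) = fun _ => 1 := fun a => rfl
  simp only [levelSum, e]
  rw [h]
  field_simp

/-- A nonnegative solution of a contracting linear recurrence with summable source is summable. -/
lemma hasSum_of_contracting {α β : ℕ → ℝ} {r B : ℝ} (hr1 : r < 1)
    (hα : ∀ l, 0 ≤ α l) (hβ0 : ∀ l, 0 ≤ β l) (hβ : HasSum β B)
    (h : ∀ l, α (l + 1) = r * α l + β l) : HasSum α ((α 0 + B) / (1 - r)) := by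
  have h1 : 0 < 1 - r := by linarith
  have hs : Summable α := by
    refine summable_of_sum_range_le (c := (α 0 + B) / (1 - r)) hα fun n => ?_
    have hB : ∀ n, ∑ i ∈ Finset.range n, β i ≤ B := fun n => sum_le_hasSum _ (fun i _ => hβ0 i) hβ
    rw [le_div_iff₀ h1]
    -- The recurrence summed over the first n steps; dropping `α n ≥ 0` bounds (1 - r) times the
    -- partial sum by `α 0 + B`.
    have key : ∑ i ∈ Finset.range n, α i + α n
        = α 0 + r * ∑ i ∈ Finset.range n, α i + ∑ i ∈ Finset.range n, β i := by
      induction n with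
      | zero => simp
      | succ n ih => rw [Finset.sum_range_succ, h, Finset.sum_range_succ, mul_add]; linarith
    nlinarith [hB n, hα n]
  have ht : ∑' l, α l = α 0 + (r * ∑' l, α l + B) := by
    conv_lhs => rw [hs.tsum_eq_zero_add]
    simp only [h]
    rw [(hs.mul_left r).tsum_add hβ.summable, tsum_mul_left, hβ.tsum_eq]
  have : (α 0 + B) / (1 - r) = ∑' l, α l := by
    rw [div_eq_iff h1.ne']; linarith
  rw [this]
  exact hs.hasSum

/-- For k = 0 this is the geometric series of ratio 1 - 1/b starting at 1, with sum b. For k + 1 the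
initial value is 0 and the source has total mass (1/b) b = 1, which again gives b. The mass is thus
independent of k. -/
lemma hasSum_levelSum_one {b d : ℕ} (hdb : d < b) (k : ℕ) :
    HasSum (fun l => levelSum b d l (k : ℤ) (fun _ => 1)) (b : ℝ) := by
  have hb : (0 : ℝ) < b := by exact_mod_cast (Nat.zero_le d).trans_lt hdb
  have hr1 : 1 - 1 / (b : ℝ) < 1 := by linarith [div_pos one_pos hb]
  induction k with
  | zero =>
    have := hasSum_of_contracting (β := fun _ => 0) (B := 0) hr1
      (fun l => levelSum_one_nonneg b d l 0) (fun _ => le_rfl) hasSum_zero (fun l => by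
        rw [levelSum_one_succ hdb, levelSum_neg_index b d l (0 - 1) _ (by norm_num), mul_zero])
    simpa [levelSum] using this
  | succ k ih =>
    have := hasSum_of_contracting (β := fun l => 1 / (b : ℝ) * levelSum b d l k (fun _ => 1))
      (B := 1 / (b : ℝ) * b) hr1
      (fun l => levelSum_one_nonneg b d l ((k + 1 : ℕ) : ℤ))
      (fun l => mul_nonneg (by positivity) (levelSum_one_nonneg b d l _)) (ih.mul_left _) (fun l => by
        rw [levelSum_one_succ hdb, Nat.cast_succ, add_sub_cancel_right])
    have h0 : ((k : ℤ) + 1) ≠ 0 := by omega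
    have e : (levelSum b d 0 ((k + 1 : ℕ) : ℤ) (fun _ => 1) + 1 / (b : ℝ) * b) / (1 - (1 - 1 / (b : ℝ)))
        = b := by
      simp only [levelSum, Nat.cast_succ, h0, if_false]
      field_simp
      ring
    rwa [e] at this

lemma summable_levelSum_one {b d : ℕ} (hdb : d < b) (k : ℤ) :
    Summable (fun l => levelSum b d l k (fun _ => 1)) := by
  rcases lt_or_ge k 0 with hk | hk
  · simp only [fun l => levelSum_neg_index b d l k (fun _ => 1) hk]
    exact summable_zero
  · lift k to ℕ using hk
    exact (hasSum_levelSum_one hdb k).summable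

lemma stringSum_neg_index (b d : ℕ) {k : ℤ} (hk : k < 0) (f : ℝ → ℝ) : stringSum b d k f = 0 := by
  simp [stringSum, levelSum_neg_index b d _ k f hk]

lemma stringSum_one {b d : ℕ} (hdb : d < b) (k : ℕ) : stringSum b d k (fun _ => 1) = b :=
  (hasSum_levelSum_one hdb k).tsum_eq

lemma summable_levelSum {b d : ℕ} (hdb : d < b) (k : ℤ) {f : ℝ → ℝ} {C : ℝ} (hf : UnitBound f C) :
    Summable (fun l => levelSum b d l k f) :=
  Summable.of_norm_bounded ((summable_levelSum_one hdb k).mul_left C)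
    (fun l => abs_levelSum_le b d l k f hf)

lemma abs_stringSum_le {b d : ℕ} (hdb : d < b) (k : ℤ) {f : ℝ → ℝ} {C : ℝ} (hf : UnitBound f C) :
    |stringSum b d k f| ≤ C * b := by
  have hC : 0 ≤ C := (abs_nonneg _).trans (hf 0 (by simp))
  rcases lt_or_ge k 0 with hk | hk
  · rw [stringSum_neg_index b d hk, abs_zero]; positivity
  · lift k to ℕ using hk
    exact tsum_of_norm_bounded (f := fun l => levelSum b d l (k : ℤ) f) ((hasSum_levelSum_one hdb k).mul_left C)
      (fun l => abs_levelSum_le b d l k f hf)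

lemma stringSum_sum {ι : Type*} {b d : ℕ} (hdb : d < b) (k : ℤ) (s : Finset ι) (c : ι → ℝ)
    (f : ι → ℝ → ℝ) (B : ι → ℝ) (hf : ∀ i ∈ s, UnitBound (f i) (B i)) :
    stringSum b d k (fun x => ∑ i ∈ s, c i * f i x) = ∑ i ∈ s, c i * stringSum b d k (f i) := by
  simp only [stringSum, levelSum_sum, ← tsum_mul_left]
  rw [Summable.tsum_finsetSum]
  exact fun i hi => (summable_levelSum hdb k (hf i hi)).mul_left _

/-- A string is empty, giving the point 0, or is its first digit followed by a string; this is the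
self-similarity of the measure. -/
lemma stringSum_rec {b d : ℕ} (hdb : d < b) (k : ℤ) {f : ℝ → ℝ} {C : ℝ} (hf : UnitBound f C) :
    stringSum b d k f = (if k = 0 then f 0 else 0)
      + (∑ a ∈ Finset.range b, stringSum b d (k - if a = d then 1 else 0) (digitPull b a f)) / b := by
  conv_lhs => rw [stringSum, (summable_levelSum hdb k hf).tsum_eq_zero_add]
  simp only [levelSum, stringSum]
  rw [tsum_div_const, Summable.tsum_finsetSum]
  exact fun a ha => summable_levelSum hdb _ (hf.digitPull (Finset.mem_range.1 ha))

lemma unitBound_pow (m : ℕ) : UnitBound (fun x => x ^ m) 1 := fun x hx => by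
  rw [abs_of_nonneg (pow_nonneg hx.1 _)]
  exact pow_le_one₀ hx.1 hx.2

/-! ### Moments -/

/-- The excess of the `m`-th moment over the one of `b` times the Lebesgue measure. -/
noncomputable def excessMoment (d : ℕ) (k : ℤ) (m b : ℕ) : ℝ :=
  stringSum b d k (fun x => x ^ m) - b / (m + 1)

lemma excessMoment_zero {b d : ℕ} (hdb : d < b) (k : ℕ) : excessMoment d k 0 b = 0 := by
  simp [excessMoment, stringSum_one hdb]

/-- The seed of the recursion in k: with no strings at all, the excess is minus the Lebesgue moment.
-/
lemma excessMoment_neg (d m b : ℕ) : excessMoment d (-1) m b = -(b / (m + 1)) := by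
  simp [excessMoment, stringSum_neg_index b d (show (-1 : ℤ) < 0 by norm_num)]

/-- Both sides are the integral of (a + x)^m over 0 ≤ x ≤ 1. -/
lemma sum_choose_mul_div (m : ℕ) (a : ℝ) :
    ∑ j ∈ Finset.range (m + 1), (m.choose j : ℝ) * a ^ j / ((m - j : ℕ) + 1)
      = ((a + 1) ^ (m + 1) - a ^ (m + 1)) / (m + 1) := by
  have h : (a + 1) ^ (m + 1) - a ^ (m + 1)
      = ∑ j ∈ Finset.range (m + 1), a ^ j * ((m + 1).choose j : ℝ) := by
    rw [add_pow, Finset.sum_range_succ]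
    simp
  rw [h, Finset.sum_div]
  refine Finset.sum_congr rfl fun j hj => ?_
  have hj' : j ≤ m := Nat.lt_succ_iff.1 (Finset.mem_range.1 hj)
  have e := Nat.choose_mul_succ_eq m j
  rw [Nat.succ_sub hj'] at e
  have e' : (m.choose j : ℝ) * (m + 1) = (m + 1).choose j * ((m - j : ℕ) + 1) := by exact_mod_cast e
  have h1 : ((m : ℝ) + 1) ≠ 0 := by positivity
  have h2 : (((m - j : ℕ) : ℝ) + 1) ≠ 0 := by positivity
  rw [div_eq_div_iff h2 h1]
  linear_combination a ^ j * e'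

/-- Cutting [0, b] into unit intervals: the Lebesgue moments satisfy the same recursion as the
measures. -/
lemma sum_choose_mul_sum_pow (m b : ℕ) :
    ∑ j ∈ Finset.range (m + 1), (m.choose j : ℝ) * (∑ a ∈ Finset.range b, (a : ℝ) ^ j)
      / ((m - j : ℕ) + 1) = (b : ℝ) ^ (m + 1) / (m + 1) := by
  simp only [Finset.mul_sum, Finset.sum_div]
  rw [Finset.sum_comm]
  simp only [sum_choose_mul_div]
  rw [← Finset.sum_div]
  congr 1
  have := Finset.sum_range_sub (fun a : ℕ => (a : ℝ) ^ (m + 1)) b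
  simpa using this

lemma stringSum_pow_rec {b d : ℕ} (hdb : d < b) (k : ℤ) (m : ℕ) :
    (b : ℝ) ^ (m + 1) * stringSum b d k (fun x => x ^ m)
      = (if k = 0 then (b : ℝ) ^ (m + 1) * 0 ^ m else 0)
      + ∑ j ∈ Finset.range (m + 1), (m.choose j : ℝ)
        * (((∑ a ∈ Finset.range b, (a : ℝ) ^ j) - d ^ j) * stringSum b d k (fun x => x ^ (m - j))
          + d ^ j * stringSum b d (k - 1) (fun x => x ^ (m - j))) := by
  have hb : (b : ℝ) ≠ 0 := by
    have : b ≠ 0 := by omega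
    exact_mod_cast this
  have h1 : ∀ a, digitPull b a (fun x => x ^ m) = fun x => ∑ j ∈ Finset.range (m + 1),
      ((m.choose j : ℝ) * (a : ℝ) ^ j / (b : ℝ) ^ m) * x ^ (m - j) := by
    intro a
    funext x
    simp only [digitPull]
    rw [div_pow, add_pow, Finset.sum_div]
    exact Finset.sum_congr rfl fun j _ => by ring
  rw [stringSum_rec hdb k (unitBound_pow m)]
  simp only [h1]
  have h2 : ∀ a, stringSum b d (k - if a = d then 1 else 0) (fun x => ∑ j ∈ Finset.range (m + 1),
      ((m.choose j : ℝ) * (a : ℝ) ^ j / (b : ℝ) ^ m) * x ^ (m - j))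
      = ∑ j ∈ Finset.range (m + 1), ((m.choose j : ℝ) * (a : ℝ) ^ j / (b : ℝ) ^ m)
        * stringSum b d (k - if a = d then 1 else 0) (fun x => x ^ (m - j)) := fun a =>
    stringSum_sum hdb _ _ _ _ (fun _ => 1) (fun i _ => unitBound_pow _)
  simp only [h2]
  rw [mul_add, Finset.sum_comm, mul_ite, mul_zero]
  congr 1
  rw [Finset.sum_div, Finset.mul_sum]
  refine Finset.sum_congr rfl fun j _ => ?_
  have h3 := sum_range_digit hdb (fun a => (a : ℝ) ^ j)
    (fun k => stringSum b d k (fun x => x ^ (m - j))) k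
  rw [← h3, Finset.mul_sum, Finset.sum_div, Finset.mul_sum]
  refine Finset.sum_congr rfl fun a _ => ?_
  field_simp
  ring

/-- The Lebesgue moments subtracted in the two terms with `d ^ j` cancel, and the remaining ones
satisfy the recursion by `sum_choose_mul_sum_pow`, so the excesses obey it without a new source. The
empty string contributes 0^m = 0 because m is nonzero. -/
lemma excessMoment_rec {b d : ℕ} (hdb : d < b) (k : ℤ) (m : ℕ) (hm : m ≠ 0) :
    (b : ℝ) ^ (m + 1) * excessMoment d k m b
      = ∑ j ∈ Finset.range (m + 1), (m.choose j : ℝ)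
        * (((∑ a ∈ Finset.range b, (a : ℝ) ^ j) - d ^ j) * excessMoment d k (m - j) b
          + d ^ j * excessMoment d (k - 1) (m - j) b) := by
  have h := stringSum_pow_rec hdb k m
  rw [zero_pow hm, mul_zero, ite_self, zero_add] at h
  have h2 := sum_choose_mul_sum_pow m b
  unfold excessMoment
  rw [mul_sub, h, mul_div_assoc', mul_comm, mul_div_assoc, ← h2, Finset.mul_sum,
    ← Finset.sum_sub_distrib]
  refine Finset.sum_congr rfl fun j _ => ?_
  ring

/-! ### The Irwin sum through blocks of integers with given leading digits -/

lemma sum_Ico_mul {N M : ℕ} (hNM : N ≤ M) (B : ℕ) (f : ℕ → ℝ) :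
    ∑ i ∈ Finset.Ico (N * B) (M * B), f i
      = ∑ a ∈ Finset.Ico N M, ∑ i ∈ Finset.Ico (a * B) ((a + 1) * B), f i := by
  induction M, hNM using Nat.le_induction with
  | base => simp
  | succ M hM ih =>
    rw [Finset.sum_Ico_succ_top hM, ← ih, Finset.sum_Ico_consecutive _
      (Nat.mul_le_mul_right B hM) (Nat.mul_le_mul_right B (Nat.le_succ M))]

/-- The number of digits of `n` equal to `d` in base `b`. -/
def digitCount (b d n : ℕ) : ℕ := (Nat.digits b n).count d

lemma digitCount_mul_add {b : ℕ} (hb : 1 < b) (d : ℕ) {n a : ℕ} (hn : 0 < n) (ha : a < b) :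
    digitCount b d (n * b + a) = digitCount b d n + if a = d then 1 else 0 := by
  unfold digitCount
  rw [add_comm (n * b), mul_comm n b, Nat.digits_add b hb a n ha (Or.inr hn.ne'), List.count_cons]
  simp

lemma digitCount_of_lt {b : ℕ} (d : ℕ) {a : ℕ} (ha0 : 0 < a) (ha : a < b) :
    digitCount b d a = if a = d then 1 else 0 := by
  unfold digitCount
  rw [Nat.digits_of_lt b a ha0.ne' ha, List.count_singleton]
  simp

/-- The sum of `1 / m` over the integers `m` with leading part `n` followed by `l` digits and with
exactly `κ` digits `d`. -/
noncomputable def blockSum (b d κ l n : ℕ) : ℝ :=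
  ∑ m ∈ Finset.Ico (n * b ^ l) ((n + 1) * b ^ l), if digitCount b d m = κ then 1 / (m : ℝ) else 0

lemma levelSum_mul_left (b d l : ℕ) (k : ℤ) (c : ℝ) (f : ℝ → ℝ) :
    levelSum b d l k (fun x => c * f x) = c * levelSum b d l k f := by
  simpa using levelSum_sum b d {()} (fun _ => c) (fun _ => f) l k

/-- Induction on the number of trailing digits: the first of them is absorbed into the leading part,
n becoming n b + a. -/
lemma blockSum_eq_levelSum {b d : ℕ} (hb : 1 < b) (κ l : ℕ) : ∀ n : ℕ, 0 < n →
    blockSum b d κ l n = levelSum b d l ((κ : ℤ) - digitCount b d n) (fun x => 1 / (n + x)) := by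
  induction l with
  | zero =>
    intro n _
    have : ((κ : ℤ) - digitCount b d n = 0) ↔ digitCount b d n = κ := by omega
    simp [blockSum, levelSum, this]
  | succ l ih =>
    intro n hn
    have hb0 : (b : ℝ) ≠ 0 := by
      have : b ≠ 0 := by omega
      exact_mod_cast this
    have h1 : blockSum b d κ (l + 1) n = ∑ a ∈ Finset.range b, blockSum b d κ l (n * b + a) := by
      unfold blockSum
      rw [pow_succ', ← mul_assoc, ← mul_assoc, sum_Ico_mul (Nat.mul_le_mul_right b (Nat.le_succ n)),
        Finset.sum_Ico_eq_sum_range]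
      have : (n + 1) * b - n * b = b := by rw [add_one_mul]; omega
      rw [this]
    rw [h1, levelSum, Finset.sum_div]
    refine Finset.sum_congr rfl fun a ha => ?_
    have ha' := Finset.mem_range.1 ha
    -- The factor b produced here cancels the division by b in `levelSum`.
    have h2 : digitPull b a (fun x => 1 / ((n : ℝ) + x))
        = fun x => (b : ℝ) * (1 / (((n * b + a : ℕ) : ℝ) + x)) := by
      funext x
      have : (n : ℝ) + (a + x) / b = (((n * b + a : ℕ) : ℝ) + x) / b := by
        push_cast
        field_simp
        ring
      simp only [digitPull]
      rw [this, one_div_div, mul_one_div]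
    rw [ih (n * b + a) (Nat.add_pos_left (Nat.mul_pos hn (by omega)) a), h2, levelSum_mul_left,
      mul_div_cancel_left₀ _ hb0, digitCount_mul_add hb d hn ha']
    congr 1
    push_cast
    split_ifs <;> ring

/-- Integers below b contain at most one digit d, so nothing is lost by taking leading parts with
two digits. This choice ensures n ≥ b, which makes the Taylor expansion in 1/n effective. -/
lemma sum_range_pow_eq_blockSum {b d : ℕ} (hb : 1 < b) (L : ℕ) :
    ∑ m ∈ Finset.range (b ^ (L + 1)), (if digitCount b d m = 2 then 1 / (m : ℝ) else 0)
      = ∑ n ∈ Finset.Ico b (b ^ 2), ∑ l ∈ Finset.range L, blockSum b d 2 l n := by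
  induction L with
  | zero =>
    simp only [zero_add, pow_one, Finset.range_zero, Finset.sum_empty, Finset.sum_const_zero]
    refine Finset.sum_eq_zero fun m hm => ?_
    rcases Nat.eq_zero_or_pos m with rfl | h0
    · simp
    · rw [digitCount_of_lt d h0 (Finset.mem_range.1 hm), if_neg]
      split_ifs <;> norm_num
  | succ L ih =>
    simp only [Finset.sum_range_succ, Finset.sum_add_distrib]
    rw [← ih, ← Finset.sum_range_add_sum_Ico _
      (Nat.pow_le_pow_right (by omega : 0 < b) (Nat.le_succ (L + 1)))]
    congr 1
    have h1 : b ^ (L + 1) = b * b ^ L := pow_succ' b L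
    have h2 : b ^ (L + 1 + 1) = b ^ 2 * b ^ L := by ring
    have h3 : b ≤ b ^ 2 := by nlinarith
    rw [h1] at *
    rw [Nat.succ_eq_add_one, h2, sum_Ico_mul h3]
    rfl

lemma unitBound_one_div {n : ℝ} (hn : 1 ≤ n) : UnitBound (fun x => 1 / (n + x)) 1 := by
  intro x hx
  have h : 1 ≤ n + x := by linarith [hx.1]
  rw [abs_of_nonneg (by positivity), div_le_one (by linarith)]
  exact h

/-- The terms are nonnegative, so it suffices to follow the partial sums along the powers of b. -/
lemma hasSum_irwin {b d : ℕ} (hb : 1 < b) (hdb : d < b) :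
    HasSum (fun m : ℕ => if digitCount b d m = 2 then 1 / (m : ℝ) else 0)
      (∑ n ∈ Finset.Ico b (b ^ 2),
        stringSum b d (2 - digitCount b d n) (fun x => 1 / ((n : ℝ) + x))) := by
  have h0 : ∀ m : ℕ, 0 ≤ if digitCount b d m = 2 then 1 / (m : ℝ) else 0 := fun m => by
    split_ifs <;> positivity
  rw [hasSum_iff_tendsto_nat_of_nonneg h0]
  have hmono : Monotone fun n : ℕ => ∑ m ∈ Finset.range n,
      (if digitCount b d m = 2 then 1 / (m : ℝ) else 0) := fun i j hij =>
    Finset.sum_le_sum_of_subset_of_nonneg (Finset.range_mono hij) fun m _ _ => h0 m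
  have hsub : Tendsto (fun L : ℕ => b ^ (L + 1)) atTop atTop :=
    (tendsto_pow_atTop_atTop_of_one_lt hb).comp (tendsto_add_atTop_nat 1)
  rw [tendsto_iff_tendsto_subseq_of_monotone hmono hsub]
  have : (fun n : ℕ => ∑ m ∈ Finset.range n, (if digitCount b d m = 2 then 1 / (m : ℝ) else 0))
      ∘ (fun L : ℕ => b ^ (L + 1))
      = fun L => ∑ n ∈ Finset.Ico b (b ^ 2), ∑ l ∈ Finset.range L, blockSum b d 2 l n :=
    funext fun L => sum_range_pow_eq_blockSum hb L
  rw [this]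
  refine tendsto_finsetSum _ fun n hn => ?_
  have hn1 : 0 < n := by
    have := (Finset.mem_Ico.1 hn).1
    omega
  have e : ∀ l, blockSum b d 2 l n
      = levelSum b d l (2 - digitCount b d n) (fun x => 1 / ((n : ℝ) + x)) := fun l =>
    blockSum_eq_levelSum hb 2 l n hn1
  simp only [e]
  exact (summable_levelSum hdb _ (unitBound_one_div (by exact_mod_cast hn1))).hasSum.tendsto_sum_nat

lemma irwinSet_indicator (b d : ℕ) :
    (irwinSet b d 2).indicator (fun m : ℕ => 1 / (m : ℝ))
      = fun m : ℕ => if digitCount b d m = 2 then 1 / (m : ℝ) else 0 := by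
  funext m
  rcases Nat.eq_zero_or_pos m with rfl | h0
  · simp [Set.indicator]
  · by_cases h : (Nat.digits b m).count d = 2 <;>
      simp [Set.indicator, irwinSet, digitCount, h, h0]

lemma hasSum_irwinSet {b d : ℕ} (hb : 1 < b) (hdb : d < b) :
    HasSum (fun m : irwinSet b d 2 => 1 / ((m : ℕ) : ℝ)) (∑ n ∈ Finset.Ico b (b ^ 2),
        stringSum b d (2 - digitCount b d n) (fun x => 1 / ((n : ℝ) + x))) := by
  have := hasSum_irwin hb hdb
  rw [← irwinSet_indicator] at this
  exact (hasSum_subtype_iff_indicator (f := fun m : ℕ => 1 / (m : ℝ))).2 this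

lemma irwinSum_two_eq {b d : ℕ} (hb : 1 < b) (hdb : d < b) :
    irwinSum b d 2 = ∑ n ∈ Finset.Ico b (b ^ 2),
        stringSum b d (2 - digitCount b d n) (fun x => 1 / ((n : ℝ) + x)) :=
  (hasSum_irwinSet hb hdb).tsum_eq

/-! ### Taylor expansion of the blocks -/

lemma one_div_add_taylor {n x : ℝ} (hn : 1 ≤ n) (hx : 0 ≤ x) (M : ℕ) :
    1 / (n + x) - ∑ m ∈ Finset.range (M + 1), (-1) ^ m / n ^ (m + 1) * x ^ m
      = (-1) ^ (M + 1) * x ^ (M + 1) / (n ^ (M + 1) * (n + x)) := by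
  have h1 : n ≠ 0 := by linarith
  have h2 : n + x ≠ 0 := by linarith
  induction M with
  | zero => simp; field_simp; ring
  | succ M ih =>
    rw [Finset.sum_range_succ, ← sub_sub, ih]
    field_simp
    ring

lemma stringSum_one_div_taylor {b d : ℕ} (hdb : d < b) (k : ℤ) {n : ℝ} (hn : 1 ≤ n) (M : ℕ) :
    |stringSum b d k (fun x => 1 / (n + x)) - ∑ m ∈ Finset.range (M + 1),
      (-1) ^ m / n ^ (m + 1) * stringSum b d k (fun x => x ^ m)| ≤ 1 / n ^ (M + 2) * b := by
  have hn0 : 0 < n := by linarith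
  have hR : UnitBound (fun x => (-1) ^ (M + 1) * x ^ (M + 1) / (n ^ (M + 1) * (n + x)))
      (1 / n ^ (M + 2)) := by
    intro x hx
    have hx1 : x ^ (M + 1) ≤ 1 := pow_le_one₀ hx.1 hx.2
    have hx0 : 0 ≤ x ^ (M + 1) := pow_nonneg hx.1 _
    have hnx : n ≤ n + x := by linarith [hx.1]
    have hnx0 : 0 < n + x := by linarith
    rw [abs_div, abs_mul, abs_pow, abs_neg, abs_one, one_pow, one_mul, abs_of_nonneg hx0,
      abs_of_pos (by positivity), pow_succ n (M + 1)]
    gcongr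
  -- The remainder is treated as one more term, of index M + 1, so that linearity over a finite sum
  -- covers the whole expansion.
  let F : ℕ → ℝ → ℝ := fun m x => if m ≤ M then x ^ m else
    (-1) ^ (M + 1) * x ^ (M + 1) / (n ^ (M + 1) * (n + x))
  let c : ℕ → ℝ := fun m => if m ≤ M then (-1) ^ m / n ^ (m + 1) else 1
  have hF : ∀ m ∈ Finset.range (M + 2), UnitBound (F m) (1 + 1 / n ^ (M + 2)) := by
    intro m _ x hx
    by_cases hm : m ≤ M
    · simp only [F, hm, if_true]
      have : 0 ≤ 1 / n ^ (M + 2) := by positivity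
      linarith [unitBound_pow m x hx]
    · simp only [F, hm, if_false]
      linarith [hR x hx]
  have hlast : ¬ (M + 1 ≤ M) := by omega
  have hU := stringSum_sum hdb k (Finset.range (M + 2)) c F _ hF
  rw [Finset.sum_range_succ] at hU
  have e1 : ∑ i ∈ Finset.range (M + 1), c i * stringSum b d k (F i) = ∑ m ∈ Finset.range (M + 1),
      (-1) ^ m / n ^ (m + 1) * stringSum b d k (fun x => x ^ m) := by
    refine Finset.sum_congr rfl fun m hm => ?_
    have : m ≤ M := Nat.lt_succ_iff.1 (Finset.mem_range.1 hm)
    simp [c, F, this]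
  -- The functional only sees [0,1], where the Taylor identity holds; elsewhere n + x may vanish.
  have hext : ∀ f g : ℝ → ℝ, (∀ x ∈ Set.Icc (0 : ℝ) 1, f x = g x) →
      stringSum b d k f = stringSum b d k g := by
    intro f g hfg
    have hz : UnitBound (fun x => f x - g x) 0 := fun x hx => by simp [hfg x hx]
    have hl : ∀ l, levelSum b d l k f = levelSum b d l k g := by
      intro l
      have h1 := levelSum_sum b d Finset.univ (fun i : Bool => if i then (1 : ℝ) else -1)
        (fun i => if i then f else g) l k
      have h2 := abs_levelSum_le b d l k _ hz
      simp only [Fintype.sum_bool, if_true, one_mul, Bool.false_eq_true, if_false, neg_one_mul,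
        ← sub_eq_add_neg] at h1
      rw [zero_mul, h1] at h2
      linarith [abs_nonpos_iff.1 h2]
    simp only [stringSum, hl]
  have e2 : stringSum b d k (fun x => ∑ i ∈ Finset.range (M + 2), c i * F i x)
      = stringSum b d k (fun x => 1 / (n + x)) := by
    refine hext _ _ fun x hx => ?_
    have := one_div_add_taylor hn hx.1 M
    rw [Finset.sum_range_succ]
    have e3 : ∑ i ∈ Finset.range (M + 1), c i * F i x
        = ∑ m ∈ Finset.range (M + 1), (-1) ^ m / n ^ (m + 1) * x ^ m := by
      refine Finset.sum_congr rfl fun m hm => ?_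
      have : m ≤ M := Nat.lt_succ_iff.1 (Finset.mem_range.1 hm)
      simp [c, F, this]
    rw [e3]
    simp only [c, F, hlast, if_false, one_mul]
    rw [← this]
    ring
  rw [e1, e2] at hU
  rw [hU, add_sub_cancel_left]
  simp only [c, F, hlast, if_false, one_mul]
  exact abs_stringSum_le hdb k hR

/-- The logarithmic difference is the integral of 1/(n + x) over [0,1], so the Taylor coefficients
are those of `one_div_add_taylor` paired with the Lebesgue moments 1/(m+1). The factor 2 bounds 1/(1
- 1/n) for n ≥ 2. -/
lemma log_succ_div_taylor {n : ℝ} (hn : 2 ≤ n) (M : ℕ) :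
    |Real.log (n + 1) - Real.log n - ∑ m ∈ Finset.range (M + 1),
      (-1) ^ m / n ^ (m + 1) * (1 / ((m : ℝ) + 1))| ≤ 2 * (1 / n ^ (M + 2)) := by
  have hn0 : 0 < n := by linarith
  have habs : |(-1 / n)| = 1 / n := by rw [abs_div, abs_neg, abs_one, abs_of_pos hn0]
  have hh : 1 / n ≤ 1 / 2 := one_div_le_one_div_of_le (by norm_num) hn
  have h := Real.abs_log_sub_add_sum_range_le (x := -1 / n) (by rw [habs]; linarith) (M + 1)
  have e1 : 1 - -1 / n = (n + 1) / n := by field_simp; ring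
  rw [e1, Real.log_div (by linarith) hn0.ne', habs] at h
  have e2 : ∑ i ∈ Finset.range (M + 1), (-1 / n) ^ (i + 1) / ((i : ℝ) + 1)
      = - ∑ m ∈ Finset.range (M + 1), (-1) ^ m / n ^ (m + 1) * (1 / ((m : ℝ) + 1)) := by
    rw [← Finset.sum_neg_distrib]
    refine Finset.sum_congr rfl fun m _ => ?_
    rw [div_pow]
    ring
  rw [e2, neg_add_eq_sub] at h
  refine h.trans ?_
  rw [div_le_iff₀ (by linarith), div_pow, one_pow]
  have : 0 ≤ 1 / n ^ (M + 2) := by positivity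
  nlinarith

/-- Difference of the two Taylor expansions, with constant 3 = 1 + 2. The order zero term is absent
because the total mass is exactly b. -/
lemma block_expansion {b d : ℕ} (hdb : d < b) (k : ℕ) {n : ℝ} (hn : 2 ≤ n) (M : ℕ) :
    |stringSum b d k (fun x => 1 / (n + x)) - b * (Real.log (n + 1) - Real.log n)
      - ∑ m ∈ Finset.Icc 1 M, (-1) ^ m / n ^ (m + 1) * excessMoment d k m b|
      ≤ 3 * b * (1 / n ^ (M + 2)) := by
  have h1 := stringSum_one_div_taylor hdb (k : ℤ) (by linarith : 1 ≤ n) M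
  have h2 := mul_le_mul_of_nonneg_left (log_succ_div_taylor hn M) (Nat.cast_nonneg (α := ℝ) b)
  rw [← Nat.abs_cast b, ← abs_mul, Nat.abs_cast] at h2
  have h3 : ∑ m ∈ Finset.Icc 1 M, (-1) ^ m / n ^ (m + 1) * excessMoment d k m b
      = ∑ m ∈ Finset.range (M + 1), (-1) ^ m / n ^ (m + 1) * excessMoment d k m b := by
    rw [Finset.range_eq_Ico, Finset.sum_eq_sum_Ico_succ_bot (Nat.succ_pos M),
      excessMoment_zero hdb, mul_zero, zero_add]
    rfl
  have h4 : ∑ m ∈ Finset.range (M + 1), (-1) ^ m / n ^ (m + 1) * excessMoment d k m b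
      = ∑ m ∈ Finset.range (M + 1), (-1) ^ m / n ^ (m + 1) * stringSum b d k (fun x => x ^ m)
        - b * ∑ m ∈ Finset.range (M + 1), (-1) ^ m / n ^ (m + 1) * (1 / ((m : ℝ) + 1)) := by
    rw [Finset.mul_sum, ← Finset.sum_sub_distrib]
    refine Finset.sum_congr rfl fun m _ => ?_
    unfold excessMoment
    ring
  rw [h3, h4]
  have h5 := abs_sub _ _ |>.trans (add_le_add h1 h2)
  refine le_trans (le_of_eq ?_) (h5.trans (le_of_eq ?_))
  · congr 1
    ring
  · ring

/-! ### Reduction to moments and power sums -/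

/-- The sum of `n ^ (-s)` over the integers with two digits. -/
noncomputable def pairSum (s b : ℕ) : ℝ := ∑ n ∈ Finset.Ico b (b ^ 2), 1 / (n : ℝ) ^ s

/-- The sum of `n ^ (-s)` over the integers with two digits, the first of which is `d`. -/
noncomputable def rowSum (d s b : ℕ) : ℝ := ∑ c ∈ Finset.range b, 1 / ((d * b + c : ℕ) : ℝ) ^ s

/-- The sum of `n ^ (-s)` over the integers with two digits, the second of which is `d`. -/
noncomputable def colSum (d s b : ℕ) : ℝ := ∑ a ∈ Finset.Ico 1 b, 1 / ((a * b + d : ℕ) : ℝ) ^ s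

/-- The term `n ^ (-s)` for the integer `n` with two digits equal to `d`. -/
noncomputable def cornerTerm (d s b : ℕ) : ℝ := 1 / ((d * b + d : ℕ) : ℝ) ^ s

/-- The contribution of the moments of order `m` to the Irwin sum. -/
noncomputable def momentTerm (d m b : ℕ) : ℝ :=
  (-1) ^ m * (excessMoment d 2 m b * pairSum (m + 1) b
    + (excessMoment d 1 m b - excessMoment d 2 m b) * (rowSum d (m + 1) b + colSum d (m + 1) b)
    + (excessMoment d 0 m b - 2 * excessMoment d 1 m b + excessMoment d 2 m b)
      * cornerTerm d (m + 1) b)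

lemma sum_two_digits {b : ℕ} (hb : 1 < b) (f : ℕ → ℝ) :
    ∑ n ∈ Finset.Ico b (b ^ 2), f n = ∑ a ∈ Finset.Ico 1 b, ∑ c ∈ Finset.range b, f (a * b + c) := by
  have h := sum_Ico_mul hb.le b f
  rw [one_mul, ← sq] at h
  rw [h]
  refine Finset.sum_congr rfl fun a _ => ?_
  rw [Finset.sum_Ico_eq_sum_range, add_one_mul, Nat.add_sub_cancel_left]

lemma digitCount_two_digits {b d a c : ℕ} (hb : 1 < b) (ha : a ∈ Finset.Ico 1 b)
    (hc : c ∈ Finset.range b) :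
    digitCount b d (a * b + c) = (if a = d then 1 else 0) + if c = d then 1 else 0 := by
  have ha' := Finset.mem_Ico.1 ha
  rw [digitCount_mul_add hb d ha'.1 (Finset.mem_range.1 hc), digitCount_of_lt d ha'.1 ha'.2]

/-- Inclusion–exclusion: correct along the row of first digit d and the column of last digit d, then
repair the corner dd by a second difference. -/
lemma sum_two_digits_count {b d : ℕ} (hd : 0 < d) (hdb : d < b) (φ : ℕ → ℕ → ℝ) :
    ∑ n ∈ Finset.Ico b (b ^ 2), φ (digitCount b d n) n
      = ∑ n ∈ Finset.Ico b (b ^ 2), φ 0 n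
        + ∑ c ∈ Finset.range b, (φ 1 (d * b + c) - φ 0 (d * b + c))
        + ∑ a ∈ Finset.Ico 1 b, (φ 1 (a * b + d) - φ 0 (a * b + d))
        + (φ 2 (d * b + d) - 2 * φ 1 (d * b + d) + φ 0 (d * b + d)) := by
  have hb : 1 < b := by omega
  rw [sum_two_digits hb, sum_two_digits hb (φ 0)]
  have h1 : ∀ a ∈ Finset.Ico 1 b, ∀ c ∈ Finset.range b,
      φ (digitCount b d (a * b + c)) (a * b + c) = φ 0 (a * b + c)
        + (if a = d then (φ 1 (a * b + c) - φ 0 (a * b + c)) else 0)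
        + (if c = d then (φ 1 (a * b + c) - φ 0 (a * b + c)) else 0)
        + (if a = d then (if c = d then
            (φ 2 (a * b + c) - 2 * φ 1 (a * b + c) + φ 0 (a * b + c)) else 0) else 0) := by
    intro a ha c hc
    rw [digitCount_two_digits hb ha hc]
    split_ifs <;> norm_num
    ring
  rw [Finset.sum_congr rfl fun a ha => Finset.sum_congr rfl (h1 a ha)]
  simp only [Finset.sum_add_distrib]
  have hdI : d ∈ Finset.Ico 1 b := Finset.mem_Ico.2 ⟨hd, hdb⟩
  have hdr : d ∈ Finset.range b := Finset.mem_range.2 hdb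
  congr 1
  · congr 1
    · congr 1
      rw [Finset.sum_eq_single_of_mem d hdI]
      · simp
      · intro a _ h; simp [h]
    · refine Finset.sum_congr rfl fun a _ => ?_
      simp [hdb]
  · rw [Finset.sum_eq_single_of_mem d hdI]
    · simp [hdb]
    · intro a _ h; simp [h]

lemma momentTerm_eq {b d : ℕ} (hd : 0 < d) (hdb : d < b) (m : ℕ) :
    ∑ n ∈ Finset.Ico b (b ^ 2), (-1) ^ m / (n : ℝ) ^ (m + 1)
      * excessMoment d (2 - digitCount b d n) m b = momentTerm d m b := by
  have h := sum_two_digits_count hd hdb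
    (fun j n => (-1) ^ m / (n : ℝ) ^ (m + 1) * excessMoment d (2 - j) m b)
  rw [h, momentTerm, pairSum, rowSum, colSum, cornerTerm]
  have e0 : (2 : ℤ) - (0 : ℕ) = 2 := by norm_num
  have e1 : (2 : ℤ) - (1 : ℕ) = 1 := by norm_num
  have e2 : (2 : ℤ) - (2 : ℕ) = 0 := by norm_num
  rw [e0, e1, e2]
  simp only [← mul_sub, ← Finset.sum_mul, mul_add, Finset.mul_sum, div_eq_mul_one_div ((-1 : ℝ) ^ m)]
  simp only [← Finset.mul_sum]
  ring

lemma sum_log_diff {N M : ℕ} (hNM : N ≤ M) :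
    ∑ n ∈ Finset.Ico N M, (Real.log ((n : ℝ) + 1) - Real.log n) = Real.log M - Real.log N := by
  have := Finset.sum_Ico_sub (fun n : ℕ => Real.log n) hNM
  simpa using this

/-- The Irwin sum minus `b log b` is a sum of moment terms, up to a small error. -/
lemma abs_irwinSum_sub_le {b d : ℕ} (hd : 0 < d) (hdb : d < b) (M : ℕ) :
    |irwinSum b d 2 - b * Real.log b - ∑ m ∈ Finset.Icc 1 M, momentTerm d m b|
      ≤ 3 * b ^ 3 * (1 / (b : ℝ) ^ (M + 2)) := by
  have hb : 1 < b := by omega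
  have hb2 : b ≤ b ^ 2 := by nlinarith
  have hb0 : (0 : ℝ) < b := by exact_mod_cast (by omega : 0 < b)
  -- The main term telescopes to b (log b^2 - log b).
  have e1 : (b : ℝ) * Real.log b = ∑ n ∈ Finset.Ico b (b ^ 2),
      (b : ℝ) * (Real.log ((n : ℝ) + 1) - Real.log n) := by
    rw [← Finset.mul_sum, sum_log_diff hb2]
    push_cast
    rw [Real.log_pow]
    push_cast
    ring
  rw [irwinSum_two_eq hb hdb, e1, ← Finset.sum_congr rfl fun m _ => momentTerm_eq hd hdb m,
    Finset.sum_comm, ← Finset.sum_sub_distrib, ← Finset.sum_sub_distrib]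
  have h2 : ∀ n ∈ Finset.Ico b (b ^ 2),
      |stringSum b d (2 - digitCount b d n) (fun x => 1 / ((n : ℝ) + x))
        - b * (Real.log ((n : ℝ) + 1) - Real.log n) - ∑ m ∈ Finset.Icc 1 M,
          (-1) ^ m / (n : ℝ) ^ (m + 1) * excessMoment d (2 - digitCount b d n) m b|
      ≤ 3 * b * (1 / (b : ℝ) ^ (M + 2)) := by
    intro n hn
    have hn' := Finset.mem_Ico.1 hn
    have hc : digitCount b d n ≤ 2 := by
      unfold digitCount
      refine List.count_le_length.trans ?_
      rw [Nat.digits_length_le_iff hb]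
      exact hn'.2
    have hk : (2 : ℤ) - digitCount b d n = ((2 - digitCount b d n : ℕ) : ℤ) := by omega
    have hbn : (b : ℝ) ≤ n := by exact_mod_cast hn'.1
    rw [hk]
    refine (block_expansion hdb _ (by exact_mod_cast (by omega : 2 ≤ n)) M).trans ?_
    gcongr
  refine (Finset.abs_sum_le_sum_abs _ _).trans ((Finset.sum_le_card_nsmul _ _ _ h2).trans ?_)
  rw [nsmul_eq_mul, Nat.card_Ico]
  have : ((b ^ 2 - b : ℕ) : ℝ) ≤ (b : ℝ) ^ 2 := by exact_mod_cast Nat.sub_le _ _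
  calc _ ≤ (b : ℝ) ^ 2 * (3 * b * (1 / (b : ℝ) ^ (M + 2))) := by gcongr
    _ = _ := by ring

/-! ### Functions with an asymptotic expansion in powers of the inverse of the variable -/

/-- `g` is `O (b ^ (-N))`. -/
def InvPowO (N : ℕ) (g : ℕ → ℝ) : Prop := g =O[atTop] fun b : ℕ => ((b : ℝ)⁻¹) ^ N

/-- `g` has an asymptotic expansion to all orders in powers of `b⁻¹`. -/
def HasInvExpansion (g : ℕ → ℝ) : Prop :=
  ∀ N, ∃ p : Polynomial ℝ, InvPowO N fun b => g b - p.eval (b : ℝ)⁻¹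

lemma InvPowO.add {N : ℕ} {f g : ℕ → ℝ} (hf : InvPowO N f) (hg : InvPowO N g) :
    InvPowO N fun b => f b + g b := IsBigO.add hf hg

lemma InvPowO.sub {N : ℕ} {f g : ℕ → ℝ} (hf : InvPowO N f) (hg : InvPowO N g) :
    InvPowO N fun b => f b - g b := IsBigO.sub hf hg

lemma InvPowO.mul {M N : ℕ} {f g : ℕ → ℝ} (hf : InvPowO M f) (hg : InvPowO N g) :
    InvPowO (M + N) fun b => f b * g b := by
  have := IsBigO.mul hf hg
  simpa only [InvPowO, pow_add] using this

lemma InvPowO.const_mul {N : ℕ} {g : ℕ → ℝ} (c : ℝ) (hg : InvPowO N g) :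
    InvPowO N fun b => c * g b := IsBigO.const_mul_left hg c

lemma InvPowO.congr {N : ℕ} {f g : ℕ → ℝ} (hf : InvPowO N f) (h : f =ᶠ[atTop] g) :
    InvPowO N g := IsBigO.congr' hf h EventuallyEq.rfl

lemma InvPowO.mono {M N : ℕ} (h : M ≤ N) {g : ℕ → ℝ} (hg : InvPowO N g) : InvPowO M g := by
  refine IsBigO.trans hg (IsBigO.of_bound 1 ?_)
  filter_upwards [eventually_ge_atTop 1] with b hb
  have hb' : (1 : ℝ) ≤ b := by exact_mod_cast hb
  rw [Real.norm_of_nonneg (by positivity), Real.norm_of_nonneg (by positivity), one_mul]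
  exact pow_le_pow_of_le_one (by positivity) (inv_le_one_of_one_le₀ hb') h

lemma invPowO_pow (N : ℕ) : InvPowO N fun b => ((b : ℝ)⁻¹) ^ N := isBigO_refl _ _

lemma invPowO_zero (N : ℕ) : InvPowO N fun _ => 0 := isBigO_zero _ _

lemma invPowO_const (c : ℝ) : InvPowO 0 fun _ => c := by
  simpa [InvPowO] using isBigO_const_const c (one_ne_zero (α := ℝ)) (atTop : Filter ℕ)

lemma InvPowO.sum {ι : Type*} {N : ℕ} {s : Finset ι} {f : ι → ℕ → ℝ}
    (h : ∀ i ∈ s, InvPowO N (f i)) : InvPowO N fun b => ∑ i ∈ s, f i b :=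
  InvPowO.congr (f := ∑ i ∈ s, f i) (IsBigO.sum h)
    (Eventually.of_forall fun b => Finset.sum_apply b s f)

lemma invPowO_eval (p : Polynomial ℝ) : InvPowO 0 fun b => p.eval (b : ℝ)⁻¹ := by
  simp only [Polynomial.eval_eq_sum_range]
  exact InvPowO.sum fun i _ => ((invPowO_pow i).mono (Nat.zero_le i)).const_mul _

lemma InvPowO.of_bound {N : ℕ} {g : ℕ → ℝ} (C : ℝ) {K : ℕ}
    (h : ∀ b, K ≤ b → |g b| ≤ C * ((b : ℝ)⁻¹) ^ N) : InvPowO N g := by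
  refine IsBigO.of_bound C ?_
  filter_upwards [eventually_ge_atTop K] with b hb
  rw [Real.norm_eq_abs, Real.norm_of_nonneg (r := ((b : ℝ)⁻¹) ^ N) (by positivity)]
  exact h b hb

lemma InvPowO.exists_bound {N : ℕ} {g : ℕ → ℝ} (h : InvPowO N g) :
    ∃ C, 0 ≤ C ∧ ∃ K, ∀ b, K ≤ b → |g b| ≤ C * ((b : ℝ)⁻¹) ^ N := by
  obtain ⟨C, hC0, hC⟩ := IsBigO.exists_nonneg h
  obtain ⟨K, hK⟩ := eventually_atTop.1 hC.bound
  refine ⟨C, hC0, K, fun b hb => ?_⟩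
  have := hK b hb
  rwa [Real.norm_eq_abs, Real.norm_of_nonneg (r := ((b : ℝ)⁻¹) ^ N) (by positivity)] at this

/-- Division by a function tending to `1`. -/
lemma InvPowO.of_one_sub_mul {N : ℕ} {h g : ℕ → ℝ} (hh : InvPowO 1 h)
    (hg : InvPowO N fun b => (1 - h b) * g b) : InvPowO N g := by
  have hlim : Tendsto h atTop (nhds 0) := by
    refine IsBigO.trans_tendsto hh ?_
    simpa using tendsto_inv_atTop_nhds_zero_nat (𝕜 := ℝ)
  have hev : ∀ᶠ b in atTop, h b < 1 / 2 := hlim.eventually (gt_mem_nhds (by norm_num))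
  refine IsBigO.trans (IsBigO.of_bound 2 ?_) hg
  filter_upwards [hev] with b hb
  rw [norm_mul, Real.norm_of_nonneg (r := 1 - h b) (by linarith)]
  nlinarith [norm_nonneg (g b)]

lemma HasInvExpansion.bounded {g : ℕ → ℝ} (hg : HasInvExpansion g) : InvPowO 0 g := by
  obtain ⟨p, hp⟩ := hg 0
  exact (hp.add (invPowO_eval p)).congr (Eventually.of_forall fun b => by ring)

lemma HasInvExpansion.congr {f g : ℕ → ℝ} (hf : HasInvExpansion f) (h : f =ᶠ[atTop] g) :
    HasInvExpansion g := fun N => by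
  obtain ⟨p, hp⟩ := hf N
  exact ⟨p, hp.congr (by filter_upwards [h] with b hb; rw [hb])⟩

lemma HasInvExpansion.const (c : ℝ) : HasInvExpansion fun _ => c := fun N =>
  ⟨Polynomial.C c, by simpa using invPowO_zero N⟩

lemma HasInvExpansion.inv : HasInvExpansion fun b => (b : ℝ)⁻¹ := fun N =>
  ⟨Polynomial.X, by simpa using invPowO_zero N⟩

lemma HasInvExpansion.add {f g : ℕ → ℝ} (hf : HasInvExpansion f) (hg : HasInvExpansion g) :
    HasInvExpansion fun b => f b + g b := fun N => by
  obtain ⟨p, hp⟩ := hf N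
  obtain ⟨q, hq⟩ := hg N
  refine ⟨p + q, (hp.add hq).congr (Eventually.of_forall fun b => ?_)⟩
  simp only [Polynomial.eval_add]
  ring

lemma HasInvExpansion.mul {f g : ℕ → ℝ} (hf : HasInvExpansion f) (hg : HasInvExpansion g) :
    HasInvExpansion fun b => f b * g b := fun N => by
  obtain ⟨p, hp⟩ := hf N
  obtain ⟨q, hq⟩ := hg N
  have h1 := hp.mul hg.bounded
  have h2 := hq.mul (invPowO_eval p)
  refine ⟨p * q, (h1.add h2).congr (Eventually.of_forall fun b => ?_)⟩
  simp only [Polynomial.eval_mul]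
  ring

lemma HasInvExpansion.const_mul {g : ℕ → ℝ} (c : ℝ) (hg : HasInvExpansion g) :
    HasInvExpansion fun b => c * g b := (HasInvExpansion.const c).mul hg

lemma HasInvExpansion.sub {f g : ℕ → ℝ} (hf : HasInvExpansion f) (hg : HasInvExpansion g) :
    HasInvExpansion fun b => f b - g b := by
  refine (hf.add (hg.const_mul (-1))).congr (Eventually.of_forall fun b => ?_)
  ring

lemma HasInvExpansion.pow {g : ℕ → ℝ} (hg : HasInvExpansion g) (n : ℕ) :
    HasInvExpansion fun b => g b ^ n := by
  induction n with
  | zero => simpa using HasInvExpansion.const 1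
  | succ n ih => simpa only [pow_succ] using ih.mul hg

lemma HasInvExpansion.sum {ι : Type*} {s : Finset ι} {f : ι → ℕ → ℝ}
    (h : ∀ i ∈ s, HasInvExpansion (f i)) : HasInvExpansion fun b => ∑ i ∈ s, f i b := by
  classical
  induction s using Finset.induction_on with
  | empty => simpa using HasInvExpansion.const 0
  | insert i s hi ih =>
    simp only [Finset.sum_insert hi]
    exact (h i (Finset.mem_insert_self i s)).add
      (ih fun j hj => h j (Finset.mem_insert_of_mem hj))

/-- Expansions modulo every error term of the form `O (b ^ (-N))` combine to an expansion. -/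
lemma HasInvExpansion.of_approx {g : ℕ → ℝ}
    (h : ∀ N, ∃ f, HasInvExpansion f ∧ InvPowO N fun b => g b - f b) : HasInvExpansion g := fun N => by
  obtain ⟨f, hf, hgf⟩ := h N
  obtain ⟨p, hp⟩ := hf N
  exact ⟨p, (hgf.add hp).congr (Eventually.of_forall fun b => by ring)⟩

lemma InvPowO.pow_self {h : ℕ → ℝ} (hh : InvPowO 1 h) (n : ℕ) : InvPowO n fun b => h b ^ n := by
  induction n with
  | zero => simpa using invPowO_const 1
  | succ n ih => simpa only [pow_succ] using ih.mul hh

/-- If `(1 - h) g` has an expansion, so has `g`. -/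
lemma HasInvExpansion.of_one_sub_mul {h g : ℕ → ℝ} (hh : HasInvExpansion h) (hh1 : InvPowO 1 h)
    (hg : HasInvExpansion fun b => (1 - h b) * g b) : HasInvExpansion g := by
  have hgb : InvPowO 0 g := InvPowO.of_one_sub_mul hh1 hg.bounded
  -- Inverting 1 - h by a truncated geometric series leaves the remainder h^N g, which is O(b^(-N))
  -- since g is bounded.
  refine HasInvExpansion.of_approx fun N =>
    ⟨fun b => ((1 - h b) * g b) * ∑ i ∈ Finset.range N, h b ^ i,
      hg.mul (HasInvExpansion.sum fun i _ => hh.pow i), ?_⟩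
  refine ((hh1.pow_self N).mul hgb).congr (Eventually.of_forall fun b => ?_)
  have := mul_neg_geom_sum (h b) N
  simp only
  linear_combination (g b) * this

lemma HasInvExpansion.comp {g : ℕ → ℝ} (hg : HasInvExpansion g) {φ : ℕ → ℕ} {c : ℝ} {j : ℕ}
    (hφ : Tendsto φ atTop atTop) (h : ∀ b, ((φ b : ℕ) : ℝ)⁻¹ = c * ((b : ℝ)⁻¹) ^ (j + 1)) :
    HasInvExpansion fun b => g (φ b) := fun N => by
  obtain ⟨p, hp⟩ := hg N
  refine ⟨p.comp (Polynomial.C c * Polynomial.X ^ (j + 1)), ?_⟩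
  have h1 := IsBigO.comp_tendsto hp hφ
  have h2 : InvPowO 1 fun b => ((φ b : ℕ) : ℝ)⁻¹ := by
    simp only [h]
    exact ((invPowO_pow (j + 1)).mono (by omega)).const_mul c
  have h3 : InvPowO N fun b => g (φ b) - p.eval ((φ b : ℕ) : ℝ)⁻¹ := IsBigO.trans h1 (h2.pow_self N)
  refine h3.congr (Eventually.of_forall fun b => ?_)
  simp [h]

/-! ### Tails of the zeta series -/

/-- Comparison with a telescoping difference; the constant 2^q comes from 1/k ≤ 2/(k+1). -/
lemma inv_pow_succ_le_telescope (q : ℕ) (hq : 1 ≤ q) {k : ℕ} (hk : 1 ≤ k) :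
    ((k : ℝ)⁻¹) ^ (q + 1) ≤ 2 ^ q * (((k : ℝ)⁻¹) ^ q - (((k + 1 : ℕ) : ℝ)⁻¹) ^ q) := by
  have hk' : (1 : ℝ) ≤ k := by exact_mod_cast hk
  have hk0 : (0 : ℝ) < k := by linarith
  set x : ℝ := (k : ℝ)⁻¹ with hx
  set y : ℝ := ((k + 1 : ℕ) : ℝ)⁻¹ with hy
  have hx0 : 0 < x := by positivity
  have hy0 : 0 < y := by positivity
  have hxy : x - y = x * y := by
    rw [hx, hy]; push_cast; field_simp; ring
  have hy2 : x ≤ 2 * y := by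
    have hx1 : x ≤ 1 := inv_le_one_of_one_le₀ hk'
    nlinarith
  obtain ⟨r, rfl⟩ := Nat.exists_eq_add_of_le' hq
  have hyx : y ≤ x := by nlinarith [mul_pos hx0 hy0]
  have h1 : x * y ^ (r + 1) ≤ x ^ (r + 1) - y ^ (r + 1) := by
    have h2 : x ^ r * y ≤ x ^ r * x := by gcongr
    have h3 : y ^ r ≤ x ^ r := by gcongr
    have h4 : y ^ r * (x * y) ≤ x ^ r * (x * y) := by gcongr
    have h5 : x ^ (r + 1) - y ^ (r + 1) = x ^ r * (x - y) + y * (x ^ r - y ^ r) := by ring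
    have h6 : y ^ r * (x * y) = x * y ^ (r + 1) := by ring
    rw [h5, hxy]
    linarith [mul_nonneg hy0.le (sub_nonneg.2 h3)]
  calc x ^ (r + 1 + 1) = x * x ^ (r + 1) := by ring
    _ ≤ x * (2 * y) ^ (r + 1) := by gcongr
    _ = 2 ^ (r + 1) * (x * y ^ (r + 1)) := by ring
    _ ≤ _ := by gcongr

/-- A null sequence whose differences are `O (k ^ (-q-1))` is `O (k ^ (-q))`. -/
lemma InvPowO.of_diff {H : ℕ → ℝ} {q : ℕ} (hq : 1 ≤ q) (hH : Tendsto H atTop (nhds 0))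
    (hd : InvPowO (q + 1) fun k => H k - H (k + 1)) : InvPowO q H := by
  obtain ⟨C, hC0, K, hK⟩ := hd.exists_bound
  have hD : Tendsto (fun n : ℕ => C * 2 ^ q * ((n : ℝ)⁻¹) ^ q) atTop (nhds 0) := by
    have h1 : Tendsto (fun n : ℕ => ((n : ℝ)⁻¹) ^ q) atTop (nhds 0) := by
      simpa [zero_pow (by omega : q ≠ 0)] using (tendsto_inv_atTop_nhds_zero_nat (𝕜 := ℝ)).pow q
    simpa using h1.const_mul (C * 2 ^ q)
  have key : ∀ G : ℕ → ℝ, Tendsto G atTop (nhds 0) →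
      (∀ k, K ≤ k → |G k - G (k + 1)| ≤ C * ((k : ℝ)⁻¹) ^ (q + 1)) →
      ∀ n, K + 1 ≤ n → G n ≤ C * 2 ^ q * ((n : ℝ)⁻¹) ^ q := by
    intro G hG hGK n hn
    -- G minus the barrier increases to 0, hence is nonpositive. Applying this to H and to -H gives
    -- the two-sided bound.
    have hm : Monotone fun j : ℕ => G (n + j) - C * 2 ^ q * (((n + j : ℕ) : ℝ)⁻¹) ^ q := by
      refine monotone_nat_of_le_succ fun j => ?_
      have h1 := (abs_le.1 (hGK (n + j) (by omega))).2
      have h2 := mul_le_mul_of_nonneg_left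
        (inv_pow_succ_le_telescope q hq (k := n + j) (by omega)) hC0
      rw [← add_assoc]
      linarith
    have hl : Tendsto (fun j : ℕ => G (n + j) - C * 2 ^ q * (((n + j : ℕ) : ℝ)⁻¹) ^ q) atTop
        (nhds 0) := by
      have h3 := (hG.sub hD).comp (tendsto_add_atTop_nat n)
      rw [sub_zero] at h3
      refine h3.congr fun j => ?_
      simp only [Function.comp_apply, add_comm j n]
    have := hm.ge_of_tendsto hl 0
    simp only [add_zero] at this
    linarith
  refine InvPowO.of_bound (C * 2 ^ q) (K := K + 1) fun n hn => abs_le.2 ⟨?_, key H hH hK n hn⟩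
  have h4 := key (fun k => -H k) (by simpa using hH.neg) (fun k hk => by
    rw [← abs_neg]
    refine le_trans (le_of_eq ?_) (hK k hk)
    congr 1
    ring) n hn
  linarith

/-- The tail `∑ k ^ (-s)`, over `k ≥ n`, of the zeta series. -/
noncomputable def zetaTail (s n : ℕ) : ℝ := ∑' k : ℕ, 1 / ((k + n : ℕ) : ℝ) ^ s

lemma summable_zetaTail {s : ℕ} (hs : 2 ≤ s) (n : ℕ) :
    Summable fun k : ℕ => 1 / ((k + n : ℕ) : ℝ) ^ s :=
  (summable_nat_add_iff (f := fun k : ℕ => 1 / (k : ℝ) ^ s) n).2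
    (Real.summable_one_div_nat_pow.2 hs)

lemma zetaTail_sub_succ {s : ℕ} (hs : 2 ≤ s) (n : ℕ) :
    zetaTail s n - zetaTail s (n + 1) = ((n : ℝ)⁻¹) ^ s := by
  rw [zetaTail, (summable_zetaTail hs n).tsum_eq_zero_add, zetaTail]
  have : ∀ k : ℕ, k + 1 + n = k + (n + 1) := fun k => by ring
  simp [this]

lemma tendsto_zetaTail (s : ℕ) : Tendsto (zetaTail s) atTop (nhds 0) :=
  tendsto_sum_nat_add fun k : ℕ => 1 / (k : ℝ) ^ s

lemma sum_Ico_eq_zetaTail {s : ℕ} (hs : 2 ≤ s) {m n : ℕ} (hmn : m ≤ n) :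
    ∑ k ∈ Finset.Ico m n, 1 / (k : ℝ) ^ s = zetaTail s m - zetaTail s n := by
  induction n, hmn using Nat.le_induction with
  | base => simp
  | succ n hn ih =>
    rw [Finset.sum_Ico_succ_top hn, ih, one_div, ← inv_pow, ← zetaTail_sub_succ hs n]
    ring

lemma zetaTail_one {s : ℕ} (hs : 2 ≤ s) : zetaTail s 1 = zetaReal s := by
  have h : riemannZeta (s : ℂ) = ((∑' n : ℕ, 1 / (n : ℝ) ^ s : ℝ) : ℂ) := by
    rw [zeta_nat_eq_tsum_of_gt_one (by omega)]
    push_cast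
    rfl
  rw [zetaReal, h, Complex.ofReal_re,
    (Real.summable_one_div_nat_pow.2 (by omega : 1 < s)).tsum_eq_zero_add, zetaTail]
  simp [zero_pow (by omega : s ≠ 0)]

/-- To approximate a tail it is enough to guess a null sequence whose differences nearly match
k^(-s); this replaces Euler–Maclaurin by algebra. -/
lemma zetaTail_sub_approx {s q : ℕ} (hs : 2 ≤ s) (hq : 1 ≤ q) {F : ℕ → ℝ}
    (hF : Tendsto F atTop (nhds 0))
    (h : InvPowO (q + 1) fun k : ℕ => ((k : ℝ)⁻¹) ^ s - (F k - F (k + 1))) :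
    InvPowO q fun n => zetaTail s n - F n := by
  refine InvPowO.of_diff hq (by simpa using (tendsto_zetaTail s).sub hF) ?_
  refine h.congr (Eventually.of_forall fun k => ?_)
  simp only [← zetaTail_sub_succ hs k]
  ring

lemma zetaTail_invPowO {s : ℕ} (hs : 2 ≤ s) : InvPowO (s - 1) (zetaTail s) := by
  have := zetaTail_sub_approx (F := fun _ => 0) hs (by omega : 1 ≤ s - 1) tendsto_const_nhds (by
    rw [Nat.sub_add_cancel (by omega)]
    simpa using invPowO_pow s)
  simpa using this

lemma hasInvExpansion_succ_ratio :
    HasInvExpansion fun n => (1 + (n : ℝ)⁻¹)⁻¹ := by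
  have hO : InvPowO 1 fun n => -1 * (n : ℝ)⁻¹ := by simpa using (invPowO_pow 1).const_mul (-1)
  refine HasInvExpansion.of_one_sub_mul (h := fun n => -1 * (n : ℝ)⁻¹)
    (HasInvExpansion.inv.const_mul (-1)) hO ?_
  refine (HasInvExpansion.const 1).congr (Eventually.of_forall fun n => ?_)
  have : (1 + (n : ℝ)⁻¹) ≠ 0 := by positivity
  simp only [neg_one_mul, sub_neg_eq_add]
  rw [mul_inv_cancel₀ this]

lemma exists_succ_inv_pow_expansion (r : ℕ) : ∃ w : ℕ → ℝ, HasInvExpansion w ∧ ∀ n : ℕ, 1 ≤ n →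
    (((n + 1 : ℕ) : ℝ)⁻¹) ^ r
      = ((n : ℝ)⁻¹) ^ r * (1 - r * (n : ℝ)⁻¹ + ((n : ℝ)⁻¹) ^ 2 * w n) := by
  induction r with
  | zero => exact ⟨fun _ => 0, HasInvExpansion.const 0, fun n _ => by simp⟩
  | succ r ih =>
    obtain ⟨w, hw, h⟩ := ih
    have he := hasInvExpansion_succ_ratio
    -- With x = 1/n and e = 1/(1+x) = 1 - x + x^2 e, this collects the terms beyond first order in
    -- (1 - r x + x^2 w)(1 - x + x^2 e).
    refine ⟨fun n => ((r + (1 + (n : ℝ)⁻¹)⁻¹ + w n) - (r * (1 + (n : ℝ)⁻¹)⁻¹ + w n) * (n : ℝ)⁻¹)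
      + w n * (1 + (n : ℝ)⁻¹)⁻¹ * ((n : ℝ)⁻¹) ^ 2, ?_, fun n hn => ?_⟩
    · exact ((((HasInvExpansion.const r).add he).add hw).sub
        (((he.const_mul r).add hw).mul HasInvExpansion.inv)).add
        ((hw.mul he).mul (HasInvExpansion.inv.pow 2))
    · have hn0 : (n : ℝ) ≠ 0 := by
        have : n ≠ 0 := by omega
        exact_mod_cast this
      have hx : 1 + (n : ℝ)⁻¹ ≠ 0 := by positivity
      have h1 : ((n + 1 : ℕ) : ℝ)⁻¹ = (n : ℝ)⁻¹ * (1 + (n : ℝ)⁻¹)⁻¹ := by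
        rw [← mul_inv, mul_add, mul_inv_cancel₀ hn0]
        push_cast
        ring
      have h2 : (1 + (n : ℝ)⁻¹)⁻¹ = 1 - (n : ℝ)⁻¹ + ((n : ℝ)⁻¹) ^ 2 * (1 + (n : ℝ)⁻¹)⁻¹ := by
        generalize (n : ℝ)⁻¹ = x at *
        field_simp
        ring
      rw [pow_succ, h n hn, h1]
      beta_reduce
      generalize (1 + (n : ℝ)⁻¹)⁻¹ = e at *
      push_cast
      generalize (n : ℝ)⁻¹ = x at *
      linear_combination x ^ (r + 1) * (1 - r * x + x ^ 2 * w n) * h2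

/-- For s = r + 1, n^(-r)/r has differences n^(-s) up to terms of order n^(-s-1) and beyond, whose
sums are tails of larger exponent. The induction variable j counts the orders missing from the
trivial bound O(n^(-(s-1))). -/
lemma exists_zetaTail_expansion (N : ℕ) : ∀ j s : ℕ, 2 ≤ s → N ≤ s - 1 + j →
    ∃ p : Polynomial ℝ, InvPowO N fun n => zetaTail s n - p.eval (n : ℝ)⁻¹ := by
  intro j
  induction j with
  | zero =>
    intro s hs hN
    exact ⟨0, by simpa using (zetaTail_invPowO hs).mono hN⟩
  | succ j ih =>
    intro s hs hN
    obtain ⟨r, rfl⟩ := Nat.exists_eq_add_of_le' (by omega : 1 ≤ s)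
    have hr : (r : ℝ) ≠ 0 := by
      have : r ≠ 0 := by omega
      exact_mod_cast this
    obtain ⟨w, hw, hwr⟩ := exists_succ_inv_pow_expansion r
    obtain ⟨p, hp⟩ := hw N
    choose q hq using fun i => ih (r + 2 + i) (by omega) (by omega)
    -- The sum of tails corrects the difference of the leading term, with w replaced by the
    -- polynomial p; only w - p survives in the defect.
    let F : ℕ → ℝ := fun n => (r : ℝ)⁻¹ * ((n : ℝ)⁻¹) ^ r
      + ∑ i ∈ Finset.range (p.natDegree + 1), ((r : ℝ)⁻¹ * p.coeff i) * zetaTail (r + 2 + i) n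
    have hF : Tendsto F atTop (nhds 0) := by
      have h1 : Tendsto (fun n : ℕ => (r : ℝ)⁻¹ * ((n : ℝ)⁻¹) ^ r) atTop (nhds 0) := by
        have := ((tendsto_inv_atTop_nhds_zero_nat (𝕜 := ℝ)).pow r).const_mul ((r : ℝ)⁻¹)
        simpa [zero_pow (by omega : r ≠ 0)] using this
      have h2 := tendsto_finsetSum (Finset.range (p.natDegree + 1)) fun i _ =>
        (tendsto_zetaTail (r + 2 + i)).const_mul ((r : ℝ)⁻¹ * p.coeff i)
      have h3 := h1.add h2
      simp only [mul_zero, Finset.sum_const_zero, add_zero] at h3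
      exact h3
    have hdiff : InvPowO (N + r + 1 + 1)
        fun k : ℕ => ((k : ℝ)⁻¹) ^ (r + 1) - (F k - F (k + 1)) := by
      have h3 := (hp.mul (invPowO_pow (r + 2))).const_mul (r : ℝ)⁻¹
      refine InvPowO.congr h3 ?_
      filter_upwards [eventually_ge_atTop 1] with k hk
      have h4 : F k - F (k + 1) = (r : ℝ)⁻¹ * (((k : ℝ)⁻¹) ^ r - (((k + 1 : ℕ) : ℝ)⁻¹) ^ r)
          + (r : ℝ)⁻¹ * ((k : ℝ)⁻¹) ^ (r + 2) * p.eval (k : ℝ)⁻¹ := by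
        have h5 : ∑ i ∈ Finset.range (p.natDegree + 1),
              ((r : ℝ)⁻¹ * p.coeff i) * zetaTail (r + 2 + i) k
            - ∑ i ∈ Finset.range (p.natDegree + 1),
              ((r : ℝ)⁻¹ * p.coeff i) * zetaTail (r + 2 + i) (k + 1)
            = (r : ℝ)⁻¹ * ((k : ℝ)⁻¹) ^ (r + 2) * p.eval (k : ℝ)⁻¹ := by
          rw [Polynomial.eval_eq_sum_range, ← Finset.sum_sub_distrib, Finset.mul_sum]
          refine Finset.sum_congr rfl fun i _ => ?_
          rw [← mul_sub, zetaTail_sub_succ (by omega)]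
          ring
        rw [← h5]
        simp only [F]
        ring
      rw [h4, hwr k hk]
      generalize (k : ℝ)⁻¹ = x
      field_simp
      ring
    have hmain := zetaTail_sub_approx (by omega) (by omega) hF hdiff
    refine ⟨Polynomial.C (r : ℝ)⁻¹ * Polynomial.X ^ r + ∑ i ∈ Finset.range (p.natDegree + 1),
      Polynomial.C ((r : ℝ)⁻¹ * p.coeff i) * q i, ?_⟩
    have h6 : InvPowO N fun n => ∑ i ∈ Finset.range (p.natDegree + 1),
        ((r : ℝ)⁻¹ * p.coeff i) * (zetaTail (r + 2 + i) n - (q i).eval (n : ℝ)⁻¹) :=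
      InvPowO.sum fun i _ => (hq i).const_mul _
    refine ((hmain.mono (by omega)).add h6).congr (Eventually.of_forall fun n => ?_)
    simp only [F, Polynomial.eval_add, Polynomial.eval_mul, Polynomial.eval_C, Polynomial.eval_pow,
      Polynomial.eval_X, Polynomial.eval_finsetSum, mul_sub, Finset.sum_sub_distrib]
    ring

lemma hasInvExpansion_zetaTail {s : ℕ} (hs : 2 ≤ s) : HasInvExpansion (zetaTail s) := fun N =>
  exists_zetaTail_expansion N N s hs (by omega)

/-! ### Expansions of the moments -/

/-- By Faulhaber's formula the normalized power sum is a polynomial in 1/b. -/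
lemma hasInvExpansion_powSum (j : ℕ) :
    HasInvExpansion fun b => ((b : ℝ)⁻¹) ^ (j + 1) * ∑ a ∈ Finset.range b, (a : ℝ) ^ j := by
  have h : HasInvExpansion fun b => ∑ i ∈ Finset.range (j + 1),
      ((bernoulli i : ℝ) * ((j + 1).choose i : ℝ) / (j + 1)) * ((b : ℝ)⁻¹) ^ i :=
    HasInvExpansion.sum fun i _ => (HasInvExpansion.inv.pow i).const_mul _
  refine h.congr ?_
  filter_upwards [eventually_ge_atTop 1] with b hb
  have hb0 : (b : ℝ) ≠ 0 := by
    have : b ≠ 0 := by omega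
    exact_mod_cast this
  have h1 : ∑ a ∈ Finset.range b, (a : ℝ) ^ j = ∑ i ∈ Finset.range (j + 1),
      (bernoulli i : ℝ) * ((j + 1).choose i : ℝ) * (b : ℝ) ^ (j + 1 - i) / (j + 1) := by
    exact_mod_cast congrArg (fun q : ℚ => (q : ℝ)) (sum_range_pow b j)
  rw [h1, Finset.mul_sum]
  refine Finset.sum_congr rfl fun i hi => ?_
  have hi' : i ≤ j + 1 := (Finset.mem_range.1 hi).le
  have h2 : ((b : ℝ)⁻¹) ^ (j + 1) * (b : ℝ) ^ (j + 1 - i) = ((b : ℝ)⁻¹) ^ i := by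
    conv_lhs => rw [← Nat.add_sub_cancel' hi', pow_add, Nat.add_sub_cancel_left, mul_assoc,
      ← mul_pow, inv_mul_cancel₀ hb0, one_pow, mul_one]
  rw [← h2]
  ring

/-- The contribution of the moments with one digit `d` less to the recursion. -/
noncomputable def momentSource (d k m b : ℕ) : ℝ :=
  ((b : ℝ)⁻¹) ^ (m + 1) * ∑ j ∈ Finset.range (m + 1),
    (m.choose j : ℝ) * d ^ j * excessMoment d ((k : ℤ) - 1) (m - j) b

/-- The term j = 0 contains the unknown moment itself, with weight (b-1) b^(-m-1), and is moved to
the left; the term j = m in the unknown index k drops out because the excess of order zero vanishes.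
The factor on the left tends to 1. -/
lemma excessMoment_rec_inv {b d : ℕ} (hdb : d < b) (k : ℕ) {m : ℕ} (hm : 1 ≤ m) :
    (1 - (((b : ℝ)⁻¹) ^ m - ((b : ℝ)⁻¹) ^ (m + 1))) * excessMoment d k m b
      = ∑ j ∈ Finset.Ico 1 m, (m.choose j : ℝ)
        * (((b : ℝ)⁻¹) ^ (j + 1) * (∑ a ∈ Finset.range b, (a : ℝ) ^ j)
          - d ^ j * ((b : ℝ)⁻¹) ^ (j + 1)) * (((b : ℝ)⁻¹) ^ (m - j) * excessMoment d k (m - j) b)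
      + momentSource d k m b := by
  have hb0 : (b : ℝ) ≠ 0 := by
    have : b ≠ 0 := by omega
    exact_mod_cast this
  have h := excessMoment_rec hdb (k : ℤ) m (by omega)
  simp only [mul_add, Finset.sum_add_distrib] at h
  rw [Finset.range_eq_Ico, Finset.sum_eq_sum_Ico_succ_bot (Nat.succ_pos m),
    Finset.sum_Ico_succ_top (by omega : 0 + 1 ≤ m)] at h
  simp only [Nat.sub_self, excessMoment_zero hdb, mul_zero, add_zero, zero_add, Nat.sub_zero,
    Nat.choose_zero_right, Nat.cast_one, pow_zero, one_mul, Finset.sum_const, Finset.card_range,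
    nsmul_eq_mul, mul_one, Nat.Ico_zero_eq_range] at h
  have hx : (b : ℝ)⁻¹ * b = 1 := inv_mul_cancel₀ hb0
  have hs : ∑ j ∈ Finset.Ico 1 m, (m.choose j : ℝ)
        * (((b : ℝ)⁻¹) ^ (j + 1) * (∑ a ∈ Finset.range b, (a : ℝ) ^ j)
          - d ^ j * ((b : ℝ)⁻¹) ^ (j + 1)) * (((b : ℝ)⁻¹) ^ (m - j) * excessMoment d k (m - j) b)
      = ((b : ℝ)⁻¹) ^ (m + 1) * ∑ j ∈ Finset.Ico 1 m, (m.choose j : ℝ)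
        * ((∑ a ∈ Finset.range b, (a : ℝ) ^ j - d ^ j) * excessMoment d k (m - j) b) := by
    rw [Finset.mul_sum]
    refine Finset.sum_congr rfl fun j hj => ?_
    have hj' := Finset.mem_Ico.1 hj
    have e : m + 1 = (j + 1) + (m - j) := by omega
    rw [e, pow_add]
    ring
  have hs2 : momentSource d k m b = ((b : ℝ)⁻¹) ^ (m + 1) * ∑ j ∈ Finset.range (m + 1),
      (m.choose j : ℝ) * (d ^ j * excessMoment d ((k : ℤ) - 1) (m - j) b) := by
    simp only [momentSource, mul_assoc]
  have hp : ((b : ℝ)⁻¹) ^ (m + 1) * (b : ℝ) ^ (m + 1) = 1 := by rw [← mul_pow, hx, one_pow]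
  have hp2 : ((b : ℝ)⁻¹) ^ (m + 1) * b = ((b : ℝ)⁻¹) ^ m := by rw [pow_succ, mul_assoc, hx, mul_one]
  rw [hs, hs2]
  linear_combination ((b : ℝ)⁻¹) ^ (m + 1) * h - excessMoment d k m b * hp
    + excessMoment d k m b * hp2

/-- The coefficient of the only term of `momentSource d 0 m`. -/
noncomputable def sourceCoeff (d m : ℕ) : ℝ :=
  ∑ j ∈ Finset.range (m + 1), (m.choose j : ℝ) * d ^ j * -(1 / ((m - j : ℕ) + 1))

lemma momentSource_zero (d m : ℕ) {b : ℕ} (hb : 1 ≤ b) :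
    momentSource d 0 m b = sourceCoeff d m * ((b : ℝ)⁻¹) ^ m := by
  have hb0 : (b : ℝ) ≠ 0 := by
    have : b ≠ 0 := by omega
    exact_mod_cast this
  have e : ((0 : ℕ) : ℤ) - 1 = -1 := by norm_num
  simp only [momentSource, sourceCoeff, e, excessMoment_neg]
  rw [Finset.mul_sum, Finset.sum_mul]
  refine Finset.sum_congr rfl fun j _ => ?_
  rw [pow_succ]
  field_simp

lemma invPowO_pow_sub {m : ℕ} (hm : 1 ≤ m) :
    InvPowO 1 fun b : ℕ => ((b : ℝ)⁻¹) ^ m - ((b : ℝ)⁻¹) ^ (m + 1) :=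
  ((invPowO_pow m).mono hm).sub ((invPowO_pow (m + 1)).mono (by omega))

lemma hasInvExpansion_excessMoment (d k : ℕ) : ∀ m, HasInvExpansion (excessMoment d k m) := by
  -- For fixed k, strong induction on m reduces everything to the source, which involves only k - 1.
  have main : ∀ k : ℕ, (∀ m, 1 ≤ m → HasInvExpansion (momentSource d k m)) →
      ∀ m, HasInvExpansion (excessMoment d k m) := by
    intro k hsrc m
    induction m using Nat.strong_induction_on with
    | _ m ih =>
      rcases Nat.eq_zero_or_pos m with rfl | hm
      · refine (HasInvExpansion.const 0).congr ?_
        filter_upwards [eventually_gt_atTop d] with b hb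
        rw [excessMoment_zero hb]
      · refine HasInvExpansion.of_one_sub_mul
          ((HasInvExpansion.inv.pow m).sub (HasInvExpansion.inv.pow (m + 1)))
          (invPowO_pow_sub hm) ?_
        have h : HasInvExpansion fun b => ∑ j ∈ Finset.Ico 1 m, (m.choose j : ℝ)
            * (((b : ℝ)⁻¹) ^ (j + 1) * (∑ a ∈ Finset.range b, (a : ℝ) ^ j)
              - d ^ j * ((b : ℝ)⁻¹) ^ (j + 1))
            * (((b : ℝ)⁻¹) ^ (m - j) * excessMoment d k (m - j) b) :=
          HasInvExpansion.sum fun j hj => (((hasInvExpansion_powSum j).sub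
            ((HasInvExpansion.inv.pow (j + 1)).const_mul _)).const_mul _).mul
            ((HasInvExpansion.inv.pow (m - j)).mul (ih (m - j) (by
              have := Finset.mem_Ico.1 hj
              omega)))
        refine (h.add (hsrc m hm)).congr ?_
        filter_upwards [eventually_gt_atTop d] with b hb
        rw [excessMoment_rec_inv hb k hm]
  induction k with
  | zero =>
    refine main 0 fun m _ => ((HasInvExpansion.inv.pow m).const_mul (sourceCoeff d m)).congr ?_
    filter_upwards [eventually_ge_atTop 1] with b hb
    rw [momentSource_zero d m hb]
  | succ k ih =>
    refine main (k + 1) fun m _ => ?_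
    unfold momentSource
    have e : ((k + 1 : ℕ) : ℤ) - 1 = k := by push_cast; ring
    simp only [e]
    exact (HasInvExpansion.inv.pow (m + 1)).mul
      (HasInvExpansion.sum fun j _ => (ih (m - j)).const_mul _)

/-- Every lower moment enters with a factor b^(-(m-j)), m - j ≥ 1, so the sum gains one order over
b^(-2k-1). For m = 1 the sum is empty and the source b^(-2k-1) decides; for m ≥ 2 both parts are
O(b^(-2k-2)). -/
lemma invPowO_excessMoment_aux (d k : ℕ)
    (hsrc : ∀ m, 1 ≤ m → InvPowO (2 * k + m) (momentSource d k m)) :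
    ∀ m, InvPowO (2 * k + 1) (excessMoment d k m) ∧
      (2 ≤ m → InvPowO (2 * k + 2) (excessMoment d k m)) := by
  intro m
  induction m using Nat.strong_induction_on with
  | _ m ih =>
    rcases Nat.eq_zero_or_pos m with rfl | hm
    · have h0 : InvPowO (2 * k + 1) (excessMoment d k 0) := by
        refine (invPowO_zero _).congr ?_
        filter_upwards [eventually_gt_atTop d] with b hb
        rw [excessMoment_zero hb]
      exact ⟨h0, fun h => by omega⟩
    · have h : InvPowO (2 * k + 2) fun b => ∑ j ∈ Finset.Ico 1 m, (m.choose j : ℝ)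
          * (((b : ℝ)⁻¹) ^ (j + 1) * (∑ a ∈ Finset.range b, (a : ℝ) ^ j)
            - d ^ j * ((b : ℝ)⁻¹) ^ (j + 1))
          * (((b : ℝ)⁻¹) ^ (m - j) * excessMoment d k (m - j) b) := by
        refine InvPowO.sum fun j hj => ?_
        have hj' := Finset.mem_Ico.1 hj
        have h1 := ((((hasInvExpansion_powSum j).sub
            ((HasInvExpansion.inv.pow (j + 1)).const_mul (d ^ j : ℝ))).const_mul
              (m.choose j : ℝ)).bounded).mul
            ((invPowO_pow (m - j)).mul (ih (m - j) (by omega)).1)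
        exact h1.mono (by omega)
      have key : ∀ N, N ≤ 2 * k + 2 → N ≤ 2 * k + m → InvPowO N (excessMoment d k m) := by
        intro N h1 h2
        refine InvPowO.of_one_sub_mul (invPowO_pow_sub hm) ?_
        refine ((h.mono h1).add ((hsrc m hm).mono h2)).congr ?_
        filter_upwards [eventually_gt_atTop d] with b hb
        rw [excessMoment_rec_inv hb k hm]
      exact ⟨key _ (by omega) (by omega), fun h2 => key _ (by omega) (by omega)⟩

/-- The prefactor b^(-m-1) times moments of order b^(-2k-1) gives b^(-2(k+1)-m): each extra digit d
gains b^(-2). -/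
lemma invPowO_momentSource (d k m : ℕ) : InvPowO (2 * k + m) (momentSource d k m) := by
  induction k generalizing m with
  | zero =>
    refine (((invPowO_pow m).const_mul (sourceCoeff d m)).mono (by omega)).congr ?_
    filter_upwards [eventually_ge_atTop 1] with b hb
    rw [momentSource_zero d m hb]
  | succ k ih =>
    unfold momentSource
    have e : ((k + 1 : ℕ) : ℤ) - 1 = k := by push_cast; ring
    simp only [e]
    have h : InvPowO (2 * k + 1) fun b => ∑ j ∈ Finset.range (m + 1),
        (m.choose j : ℝ) * d ^ j * excessMoment d k (m - j) b :=
      InvPowO.sum fun j _ =>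
        (invPowO_excessMoment_aux d k (fun m _ => ih m) (m - j)).1.const_mul _
    exact ((invPowO_pow (m + 1)).mul h).mono (by omega)

lemma invPowO_excessMoment (d k m : ℕ) : InvPowO (2 * k + 1) (excessMoment d k m) :=
  (invPowO_excessMoment_aux d k (fun m _ => invPowO_momentSource d k m) m).1

lemma invPowO_excessMoment_of_two_le (d k : ℕ) {m : ℕ} (hm : 2 ≤ m) :
    InvPowO (2 * k + 2) (excessMoment d k m) :=
  (invPowO_excessMoment_aux d k (fun m _ => invPowO_momentSource d k m) m).2 hm

/-! ### Expansions of the power sums -/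

lemma pairSum_eq {s b : ℕ} (hs : 2 ≤ s) (hb : 1 ≤ b) :
    pairSum s b = zetaTail s b - zetaTail s (b ^ 2) :=
  sum_Ico_eq_zetaTail hs (by nlinarith)

lemma rowSum_eq (d b : ℕ) {s : ℕ} (hs : 2 ≤ s) :
    rowSum d s b = zetaTail s (d * b) - zetaTail s ((d + 1) * b) := by
  rw [← sum_Ico_eq_zetaTail hs (Nat.mul_le_mul_right b (Nat.le_succ d)),
    Finset.sum_Ico_eq_sum_range, Nat.succ_mul, Nat.add_sub_cancel_left]
  rfl

lemma sum_Ico_one_eq {s b : ℕ} (hs : 2 ≤ s) (hb : 1 ≤ b) :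
    ∑ a ∈ Finset.Ico 1 b, 1 / (a : ℝ) ^ s = zetaReal s - zetaTail s b := by
  rw [sum_Ico_eq_zetaTail hs hb, zetaTail_one hs]

lemma cornerTerm_eq (d s : ℕ) {b : ℕ} (hb : 1 ≤ b) :
    cornerTerm d s b = ((d : ℝ)⁻¹) ^ s * (((b : ℝ)⁻¹) ^ s * ((1 + (b : ℝ)⁻¹)⁻¹) ^ s) := by
  have hb0 : (b : ℝ) ≠ 0 := by
    have : b ≠ 0 := by omega
    exact_mod_cast this
  have h : (((d * b + d : ℕ) : ℝ))⁻¹ = (d : ℝ)⁻¹ * ((b : ℝ)⁻¹ * (1 + (b : ℝ)⁻¹)⁻¹) := by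
    rw [← mul_inv, ← mul_inv, mul_add, mul_inv_cancel₀ hb0]
    push_cast
    ring
  rw [cornerTerm, one_div, ← inv_pow, h, mul_pow, mul_pow]

lemma hasInvExpansion_pairSum {s : ℕ} (hs : 2 ≤ s) : HasInvExpansion (pairSum s) := by
  have h1 := hasInvExpansion_zetaTail hs
  have h2 : HasInvExpansion fun b => zetaTail s (b ^ 2) :=
    h1.comp (c := 1) (j := 1) (tendsto_pow_atTop (by norm_num)) (fun b => by simp)
  refine (h1.sub h2).congr ?_
  filter_upwards [eventually_ge_atTop 1] with b hb
  rw [pairSum_eq hs hb]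

lemma tendsto_mul_left_atTop_nat {d : ℕ} (hd : 0 < d) :
    Tendsto (fun b : ℕ => d * b) atTop atTop :=
  tendsto_id.const_mul_atTop' hd

lemma hasInvExpansion_rowSum {d s : ℕ} (hd : 0 < d) (hs : 2 ≤ s) :
    HasInvExpansion (rowSum d s) := by
  have h : ∀ c : ℕ, 0 < c → HasInvExpansion fun b => zetaTail s (c * b) := fun c hc =>
    (hasInvExpansion_zetaTail hs).comp (c := (c : ℝ)⁻¹) (j := 0) (tendsto_mul_left_atTop_nat hc)
      (fun b => by simp [mul_comm])
  refine ((h d hd).sub (h (d + 1) (Nat.succ_pos d))).congr (Eventually.of_forall fun b => ?_)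
  simp only [rowSum_eq d b hs]

lemma hasInvExpansion_cornerTerm (d s : ℕ) : HasInvExpansion (cornerTerm d s) := by
  refine (((HasInvExpansion.inv.pow s).mul (hasInvExpansion_succ_ratio.pow s)).const_mul
    (((d : ℝ)⁻¹) ^ s)).congr ?_
  filter_upwards [eventually_ge_atTop 1] with b hb
  rw [cornerTerm_eq d s hb]

/-- Repeated multiplication by the truncated geometric series. Uniformity on [0,1] is needed because
it is applied at d/(ab) for all a at once. -/
lemma exists_one_add_inv_pow_approx (s J : ℕ) : ∃ p : Polynomial ℝ, ∃ C : ℝ,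
    ∀ x ∈ Set.Icc (0 : ℝ) 1, |((1 + x)⁻¹) ^ s - p.eval x| ≤ C * x ^ J := by
  induction s with
  | zero => exact ⟨1, 0, fun x _ => by simp⟩
  | succ s ih =>
    obtain ⟨p, C, h⟩ := ih
    have hC : 0 ≤ C := by
      have := h 1 (by simp)
      rw [one_pow, mul_one] at this
      exact (abs_nonneg _).trans this
    -- C is the old error times 1/(1+x) ≤ 1; 1 + C bounds |p| against the geometric remainder.
    refine ⟨p * ∑ i ∈ Finset.range J, (-Polynomial.X) ^ i, C + (1 + C), fun x hx => ?_⟩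
    have hx1 : (0 : ℝ) < 1 + x := by linarith [hx.1]
    have hxJ : 0 ≤ x ^ J := pow_nonneg hx.1 J
    have hxJ1 : x ^ J ≤ 1 := pow_le_one₀ hx.1 hx.2
    have he0 : 0 ≤ (1 + x)⁻¹ := by positivity
    have he1 : (1 + x)⁻¹ ≤ 1 := inv_le_one_of_one_le₀ (by linarith [hx.1])
    have hg : (1 + x)⁻¹ - ∑ i ∈ Finset.range J, (-x) ^ i = (1 + x)⁻¹ * (-x) ^ J := by
      have h1 := mul_neg_geom_sum (-x) J
      rw [sub_neg_eq_add] at h1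
      field_simp
      linarith
    have hp : |p.eval x| ≤ 1 + C := by
      have h2 := h x hx
      have h3 : |((1 + x)⁻¹) ^ s| ≤ 1 := by
        rw [abs_of_nonneg (by positivity)]
        exact pow_le_one₀ he0 he1
      have h4 : p.eval x = ((1 + x)⁻¹) ^ s - (((1 + x)⁻¹) ^ s - p.eval x) := by ring
      rw [h4]
      refine (abs_sub _ _).trans ?_
      nlinarith
    have e : ((1 + x)⁻¹) ^ (s + 1)
        - (p * ∑ i ∈ Finset.range J, (-Polynomial.X) ^ i).eval x
        = (((1 + x)⁻¹) ^ s - p.eval x) * (1 + x)⁻¹ + p.eval x * ((1 + x)⁻¹ * (-x) ^ J) := by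
      rw [← hg]
      simp only [Polynomial.eval_mul, Polynomial.eval_finsetSum, Polynomial.eval_pow,
        Polynomial.eval_neg, Polynomial.eval_X]
      ring
    rw [e]
    refine (abs_add_le _ _).trans ?_
    rw [abs_mul, abs_mul, abs_mul, abs_of_nonneg he0, abs_pow, abs_neg, abs_of_nonneg hx.1, add_mul]
    have h5 : |((1 + x)⁻¹) ^ s - p.eval x| * (1 + x)⁻¹ ≤ C * x ^ J * 1 :=
      mul_le_mul (h x hx) he1 he0 (mul_nonneg hC hxJ)
    have h6 : |p.eval x| * ((1 + x)⁻¹ * x ^ J) ≤ (1 + C) * (1 * x ^ J) :=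
      mul_le_mul hp (mul_le_mul_of_nonneg_right he1 hxJ) (by positivity) (by linarith)
    linarith

/-- An approximation of `(1 + x) ^ (-s)` on the unit interval gives one of `colSum`. -/
lemma colSum_approx (d : ℕ) {s J n : ℕ} (hs : 2 ≤ s) (c : ℕ → ℝ) (C : ℝ)
    (h : ∀ x ∈ Set.Icc (0 : ℝ) 1,
      |((1 + x)⁻¹) ^ s - ∑ i ∈ Finset.range n, c i * x ^ i| ≤ C * x ^ J) :
    InvPowO (s + J) fun b => colSum d s b - ((b : ℝ)⁻¹) ^ s * ∑ i ∈ Finset.range n,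
      (c i * d ^ i * ((b : ℝ)⁻¹) ^ i) * (zetaReal (s + i) - zetaTail (s + i) b) := by
  have hC : 0 ≤ C := by
    have := h 1 (by simp)
    rw [one_pow, mul_one] at this
    exact (abs_nonneg _).trans this
  refine InvPowO.of_bound (C * d ^ J * zetaReal s) (K := d + 1) fun b hb => ?_
  have hb1 : 1 ≤ b := by omega
  have hb0 : (0 : ℝ) < b := by exact_mod_cast hb1
  -- Interchanging the sums: the sum of a^(-s-i) over 1 ≤ a < b is a zeta value minus its tail.
  have h1 : ∑ i ∈ Finset.range n,
      (c i * d ^ i * ((b : ℝ)⁻¹) ^ i) * (zetaReal (s + i) - zetaTail (s + i) b)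
      = ∑ a ∈ Finset.Ico 1 b, 1 / (a : ℝ) ^ s
        * ∑ i ∈ Finset.range n, c i * (d * (b : ℝ)⁻¹ / a) ^ i := by
    simp only [Finset.mul_sum]
    rw [Finset.sum_comm]
    refine Finset.sum_congr rfl fun i _ => ?_
    rw [← sum_Ico_one_eq (by omega) hb1, Finset.mul_sum]
    refine Finset.sum_congr rfl fun a _ => ?_
    rw [div_pow, mul_pow, pow_add]
    ring
  rw [h1, colSum, Finset.mul_sum, ← Finset.sum_sub_distrib]
  refine (Finset.abs_sum_le_sum_abs _ _).trans ?_
  have h2 : ∀ a ∈ Finset.Ico 1 b, |1 / ((a * b + d : ℕ) : ℝ) ^ s - ((b : ℝ)⁻¹) ^ s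
      * (1 / (a : ℝ) ^ s * ∑ i ∈ Finset.range n, c i * (d * (b : ℝ)⁻¹ / a) ^ i)|
      ≤ C * d ^ J * ((b : ℝ)⁻¹) ^ (s + J) * (1 / (a : ℝ) ^ s) := by
    intro a ha
    have ha1 : (1 : ℝ) ≤ a := by exact_mod_cast (Finset.mem_Ico.1 ha).1
    have ha0 : (0 : ℝ) < a := by linarith
    have hdb : (d : ℝ) * (b : ℝ)⁻¹ ≤ 1 := by
      rw [← div_eq_mul_inv, div_le_one hb0]
      exact_mod_cast (by omega : d ≤ b)
    have hx0 : 0 ≤ d * (b : ℝ)⁻¹ / a := by positivity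
    have hxd : d * (b : ℝ)⁻¹ / a ≤ d * (b : ℝ)⁻¹ := div_le_self (by positivity) ha1
    have hx := h _ ⟨hx0, hxd.trans hdb⟩
    have e : 1 / ((a * b + d : ℕ) : ℝ) ^ s
        = ((b : ℝ)⁻¹) ^ s * (1 / (a : ℝ) ^ s * ((1 + d * (b : ℝ)⁻¹ / a)⁻¹) ^ s) := by
      rw [one_div, ← inv_pow, one_div, ← inv_pow, ← mul_pow, ← mul_pow, ← mul_inv, ← mul_inv]
      congr 2
      push_cast
      field_simp
    rw [e, ← mul_sub, ← mul_sub, abs_mul, abs_mul, abs_of_nonneg (by positivity : 0 ≤ ((b : ℝ)⁻¹) ^ s),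
      abs_of_nonneg (by positivity : 0 ≤ 1 / (a : ℝ) ^ s)]
    calc _ ≤ ((b : ℝ)⁻¹) ^ s * (1 / (a : ℝ) ^ s * (C * (d * (b : ℝ)⁻¹) ^ J)) := by
          gcongr
          refine hx.trans ?_
          gcongr
      _ = _ := by rw [mul_pow, pow_add]; ring
  refine (Finset.sum_le_sum h2).trans ?_
  rw [← Finset.mul_sum, sum_Ico_one_eq hs hb1]
  have h3 : 0 ≤ zetaTail s b := tsum_nonneg fun k => by positivity
  have h4 : 0 ≤ C * d ^ J * ((b : ℝ)⁻¹) ^ (s + J) := by positivity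
  nlinarith

lemma hasInvExpansion_colSum (d : ℕ) {s : ℕ} (hs : 2 ≤ s) : HasInvExpansion (colSum d s) := by
  refine HasInvExpansion.of_approx fun N => ?_
  obtain ⟨p, C, h⟩ := exists_one_add_inv_pow_approx s N
  simp only [Polynomial.eval_eq_sum_range] at h
  refine ⟨_, ?_, (colSum_approx d hs p.coeff C h).mono (by omega)⟩
  exact (HasInvExpansion.inv.pow s).mul (HasInvExpansion.sum fun i _ =>
    ((HasInvExpansion.inv.pow i).const_mul _).mul ((HasInvExpansion.const _).sub
      (hasInvExpansion_zetaTail (by omega))))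

lemma hasInvExpansion_momentTerm {d m : ℕ} (hd : 0 < d) (hm : 1 ≤ m) :
    HasInvExpansion (momentTerm d m) := by
  have hs : 2 ≤ m + 1 := by omega
  have h0 := hasInvExpansion_excessMoment d 0 m
  have h1 := hasInvExpansion_excessMoment d 1 m
  have h2 := hasInvExpansion_excessMoment d 2 m
  exact (((h2.mul (hasInvExpansion_pairSum hs)).add ((h1.sub h2).mul
    ((hasInvExpansion_rowSum hd hs).add (hasInvExpansion_colSum d hs)))).add
    (((h0.sub (h1.const_mul 2)).add h2).mul (hasInvExpansion_cornerTerm d (m + 1)))).const_mul _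

lemma irwinSum_approx {d : ℕ} (hd : 0 < d) (N : ℕ) :
    InvPowO N fun b => irwinSum b d 2 - (b : ℝ) * Real.log b
      - ∑ m ∈ Finset.Icc 1 (N + 1), momentTerm d m b := by
  refine InvPowO.of_bound 3 (K := d + 1) fun b hb => ?_
  have hb0 : (b : ℝ) ≠ 0 := by
    have : b ≠ 0 := by omega
    exact_mod_cast this
  refine (abs_irwinSum_sub_le hd (by omega) (N + 1)).trans (le_of_eq ?_)
  rw [show N + 1 + 2 = N + 3 by ring, pow_add, inv_pow]
  field_simp

/-- The Irwin sum minus `b log b` has an expansion to all orders. -/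
lemma hasInvExpansion_irwinSum {d : ℕ} (hd : 0 < d) :
    HasInvExpansion fun b => irwinSum b d 2 - (b : ℝ) * Real.log b :=
  HasInvExpansion.of_approx fun N => ⟨_, HasInvExpansion.sum fun _ hm =>
    hasInvExpansion_momentTerm hd (Finset.mem_Icc.1 hm).1, irwinSum_approx hd N⟩

/-! ### Coefficients -/

/-- The constant term is the limit, hence 0; dividing by X lowers the order by one. -/
lemma coeff_eq_zero_of_invPowO {N : ℕ} (p : Polynomial ℝ)
    (h : InvPowO N fun b => p.eval (b : ℝ)⁻¹) : ∀ i < N, p.coeff i = 0 := by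
  induction N generalizing p with
  | zero => intro i hi; omega
  | succ N ih =>
    have ht : Tendsto (fun b : ℕ => p.eval (b : ℝ)⁻¹) atTop (nhds (p.eval 0)) :=
      (p.continuous.tendsto 0).comp (tendsto_inv_atTop_nhds_zero_nat (𝕜 := ℝ))
    have ht0 : Tendsto (fun b : ℕ => p.eval (b : ℝ)⁻¹) atTop (nhds 0) := by
      refine IsBigO.trans_tendsto (h.mono (by omega : 1 ≤ N + 1)) ?_
      simpa using tendsto_inv_atTop_nhds_zero_nat (𝕜 := ℝ)
    have h0 : p.coeff 0 = 0 := by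
      rw [Polynomial.coeff_zero_eq_eval_zero]
      exact tendsto_nhds_unique ht ht0
    have hX : p = Polynomial.X * p.divX := by
      conv_lhs => rw [← Polynomial.X_mul_divX_add p, h0, Polynomial.C_0, add_zero]
    have h1 : InvPowO N fun b => p.divX.eval (b : ℝ)⁻¹ := by
      obtain ⟨C, -, K, hK⟩ := h.exists_bound
      refine InvPowO.of_bound C (K := K + 1) fun b hb => ?_
      have hb0 : (0 : ℝ) < (b : ℝ)⁻¹ := by
        have : 0 < b := by omega
        positivity
      have h2 := hK b (by omega)
      rw [hX, Polynomial.eval_mul, Polynomial.eval_X, abs_mul, abs_of_pos hb0, pow_succ',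
        mul_left_comm] at h2
      exact le_of_mul_le_mul_left h2 hb0
    intro i hi
    rcases i with _ | i
    · exact h0
    · rw [← Polynomial.coeff_divX]
      exact ih _ h1 i (by omega)

lemma eval_sum_monomial (n : ℕ) (c : ℕ → ℝ) (x : ℝ) :
    (∑ i ∈ Finset.range n, Polynomial.monomial i (c i)).eval x
      = ∑ i ∈ Finset.range n, c i * x ^ i := by
  simp [Polynomial.eval_finsetSum]

lemma coeff_sum_monomial {n i : ℕ} (hi : i < n) (c : ℕ → ℝ) :
    (∑ i ∈ Finset.range n, Polynomial.monomial i (c i)).coeff i = c i := by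
  simp [Polynomial.finsetSum_coeff, Polynomial.coeff_monomial, hi]

lemma eval_trunc_invPowO (p : Polynomial ℝ) (N : ℕ) :
    InvPowO N fun b => p.eval (b : ℝ)⁻¹ - ∑ i ∈ Finset.range N, p.coeff i * ((b : ℝ)⁻¹) ^ i := by
  have h : InvPowO N fun b => ∑ i ∈ Finset.Ico N (N + (p.natDegree + 1)),
      p.coeff i * ((b : ℝ)⁻¹) ^ i :=
    InvPowO.sum fun i hi => ((invPowO_pow i).mono (Finset.mem_Ico.1 hi).1).const_mul _
  refine h.congr (Eventually.of_forall fun b => ?_)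
  simp only
  rw [Polynomial.eval_eq_sum_range' (by omega : p.natDegree < N + (p.natDegree + 1)),
    ← Finset.sum_range_add_sum_Ico _ (Nat.le_add_right N (p.natDegree + 1))]
  ring

lemma coeff_unique {g : ℕ → ℝ} {N : ℕ} {p : Polynomial ℝ} {c : ℕ → ℝ}
    (hp : InvPowO N fun b => g b - p.eval (b : ℝ)⁻¹)
    (hc : InvPowO N fun b => g b - ∑ i ∈ Finset.range N, c i * ((b : ℝ)⁻¹) ^ i) :
    ∀ i < N, p.coeff i = c i := by
  intro i hi
  have h := coeff_eq_zero_of_invPowO (N := N)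
    (p - ∑ i ∈ Finset.range N, Polynomial.monomial i (c i)) (by
      refine (hc.sub hp).congr (Eventually.of_forall fun b => ?_)
      simp only [Polynomial.eval_sub, eval_sum_monomial]
      ring) i hi
  rw [Polynomial.coeff_sub, coeff_sum_monomial hi, sub_eq_zero] at h
  exact h

lemma HasInvExpansion.exists_coeff {g : ℕ → ℝ} (hg : HasInvExpansion g) : ∃ c : ℕ → ℝ,
    ∀ N, InvPowO N fun b => g b - ∑ i ∈ Finset.range N, c i * ((b : ℝ)⁻¹) ^ i := by
  choose p hp using hg
  -- The polynomials for different accuracies are chosen independently; uniqueness shows that they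
  -- share their low coefficients, so a diagonal choice works for all N.
  refine ⟨fun i => (p (i + 1)).coeff i, fun N => ?_⟩
  have htr : ∀ n, InvPowO n fun b => g b - ∑ i ∈ Finset.range n, (p n).coeff i * ((b : ℝ)⁻¹) ^ i := by
    intro n
    exact ((hp n).add (eval_trunc_invPowO (p n) n)).congr (Eventually.of_forall fun b => by ring)
  have h : ∀ i < N, (p (i + 1)).coeff i = (p N).coeff i := by
    intro i hi
    have h1 := (hp N).mono (by omega : i + 1 ≤ N)
    exact (coeff_unique h1 (htr (i + 1)) i (Nat.lt_succ_self i)).symm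
  refine (htr N).congr (Eventually.of_forall fun b => ?_)
  simp only
  congr 1
  exact Finset.sum_congr rfl fun i hi => by rw [h i (Finset.mem_range.1 hi)]

/-! ### Truncated expansions -/

/-- `g` is `∑ c i / b ^ (a + i)`, over `i < n`, up to `O (b ^ (-a-n))`. -/
def HasTrunc (g : ℕ → ℝ) (a n : ℕ) (c : ℕ → ℝ) : Prop :=
  InvPowO (a + n) fun b => g b - ∑ i ∈ Finset.range n, c i * ((b : ℝ)⁻¹) ^ (a + i)

/-- The sequence starting with the entries of a list and continuing by zeros. -/
def listCoeff (l : List ℝ) (i : ℕ) : ℝ := l.getD i 0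

/-- The coefficients of a product. -/
def convCoeff (c c' : ℕ → ℝ) (i : ℕ) : ℝ := ∑ j ∈ Finset.range (i + 1), c j * c' (i - j)

lemma HasTrunc.congr {f g : ℕ → ℝ} {a n : ℕ} {c : ℕ → ℝ} (hf : HasTrunc f a n c)
    (h : f =ᶠ[atTop] g) : HasTrunc g a n c :=
  InvPowO.congr hf (by filter_upwards [h] with b hb; rw [hb])

lemma HasTrunc.congr_coeff {g : ℕ → ℝ} {a n : ℕ} {c c' : ℕ → ℝ} (hg : HasTrunc g a n c)
    (h : ∀ i < n, c i = c' i) : HasTrunc g a n c' :=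
  InvPowO.congr hg (Eventually.of_forall fun b => by
    simp only
    rw [Finset.sum_congr rfl fun i hi => by rw [h i (Finset.mem_range.1 hi)]])

lemma HasTrunc.add {f g : ℕ → ℝ} {a n : ℕ} {c c' : ℕ → ℝ} (hf : HasTrunc f a n c)
    (hg : HasTrunc g a n c') : HasTrunc (fun b => f b + g b) a n fun i => c i + c' i :=
  (InvPowO.add hf hg).congr (Eventually.of_forall fun b => by
    simp only [add_mul, Finset.sum_add_distrib]
    ring)

lemma HasTrunc.const_mul {g : ℕ → ℝ} {a n : ℕ} {c : ℕ → ℝ} (r : ℝ) (hg : HasTrunc g a n c) :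
    HasTrunc (fun b => r * g b) a n fun i => r * c i :=
  (InvPowO.const_mul r hg).congr (Eventually.of_forall fun b => by
    simp only [mul_assoc, ← Finset.mul_sum]
    ring)

lemma HasTrunc.sub {f g : ℕ → ℝ} {a n : ℕ} {c c' : ℕ → ℝ} (hf : HasTrunc f a n c)
    (hg : HasTrunc g a n c') : HasTrunc (fun b => f b - g b) a n fun i => c i - c' i :=
  (InvPowO.sub hf hg).congr (Eventually.of_forall fun b => by
    simp only [sub_mul, Finset.sum_sub_distrib]
    ring)

lemma hasTrunc_self (a n : ℕ) (c : ℕ → ℝ) :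
    HasTrunc (fun b => ∑ i ∈ Finset.range n, c i * ((b : ℝ)⁻¹) ^ (a + i)) a n c :=
  (invPowO_zero _).congr (Eventually.of_forall fun b => by simp)

lemma hasTrunc_zero_iff {g : ℕ → ℝ} {a n : ℕ} :
    HasTrunc g a n (fun _ => 0) ↔ InvPowO (a + n) g := by
  simp [HasTrunc]

lemma InvPowO.hasTrunc {g : ℕ → ℝ} {N : ℕ} (hg : InvPowO N g) {a n : ℕ} (h : a + n ≤ N) :
    HasTrunc g a n fun _ => 0 := hasTrunc_zero_iff.2 (hg.mono h)

lemma HasTrunc.invPowO {g : ℕ → ℝ} {a n : ℕ} {c : ℕ → ℝ} (hg : HasTrunc g a n c) :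
    InvPowO a g := by
  have h : InvPowO a fun b => ∑ i ∈ Finset.range n, c i * ((b : ℝ)⁻¹) ^ (a + i) :=
    InvPowO.sum fun i _ => ((invPowO_pow (a + i)).mono (by omega)).const_mul _
  exact ((InvPowO.mono (by omega) hg).add h).congr (Eventually.of_forall fun b => by ring)

lemma HasTrunc.of_le {g : ℕ → ℝ} {a n n' : ℕ} {c : ℕ → ℝ} (hg : HasTrunc g a n c) (h : n' ≤ n) :
    HasTrunc g a n' c := by
  have h1 : InvPowO (a + n') fun b => ∑ i ∈ Finset.Ico n' n, c i * ((b : ℝ)⁻¹) ^ (a + i) :=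
    InvPowO.sum fun i hi => ((invPowO_pow (a + i)).mono (by
      have := (Finset.mem_Ico.1 hi).1
      omega)).const_mul _
  refine ((InvPowO.mono (by omega) hg).add h1).congr (Eventually.of_forall fun b => ?_)
  simp only
  rw [← Finset.sum_range_add_sum_Ico _ h]
  ring

/-- Padding with zeros brings expansions with different leading orders to a common one, so that they
can be added. -/
lemma HasTrunc.shift {g : ℕ → ℝ} {a n : ℕ} {c : ℕ → ℝ} (hg : HasTrunc g a n c) {a' k : ℕ}
    (h : a' + k = a) : HasTrunc g a' (k + n) fun i => if i < k then 0 else c (i - k) := by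
  subst h
  refine InvPowO.congr (InvPowO.mono (by omega) hg) (Eventually.of_forall fun b => ?_)
  simp only
  have hz : ∑ i ∈ Finset.range k, (if i < k then 0 else c (i - k)) * ((b : ℝ)⁻¹) ^ (a' + i) = 0 :=
    Finset.sum_eq_zero fun i hi => by rw [if_pos (Finset.mem_range.1 hi), zero_mul]
  rw [Finset.sum_range_add, hz, zero_add]
  congr 1
  refine Finset.sum_congr rfl fun i _ => ?_
  rw [if_neg (by omega), Nat.add_sub_cancel_left, add_assoc]

/-- The number n of known terms is preserved while the leading exponents add up. -/
lemma HasTrunc.mul {f g : ℕ → ℝ} {a a' n : ℕ} {c c' : ℕ → ℝ} (hf : HasTrunc f a n c)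
    (hg : HasTrunc g a' n c') : HasTrunc (fun b => f b * g b) (a + a') n (convCoeff c c') := by
  set p : Polynomial ℝ := ∑ i ∈ Finset.range n, Polynomial.monomial i (c i) with hp
  set q : Polynomial ℝ := ∑ i ∈ Finset.range n, Polynomial.monomial i (c' i) with hq
  have h1 := InvPowO.mul hf hg.invPowO
  have h2 := InvPowO.mul (hasTrunc_self a n c).invPowO hg
  have h3 := (invPowO_pow (a + a')).mul (eval_trunc_invPowO (p * q) n)
  have h12 := (h1.mono (by omega : a + a' + n ≤ a + n + a')).add
    (h2.mono (by omega : a + a' + n ≤ a + (a' + n)))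
  refine (h12.add h3).congr (Eventually.of_forall fun b => ?_)
  have e1 : ∀ (a : ℕ) (c : ℕ → ℝ), ∑ i ∈ Finset.range n, c i * ((b : ℝ)⁻¹) ^ (a + i)
      = ((b : ℝ)⁻¹) ^ a * ∑ i ∈ Finset.range n, c i * ((b : ℝ)⁻¹) ^ i := by
    intro a c
    rw [Finset.mul_sum]
    exact Finset.sum_congr rfl fun i _ => by rw [pow_add]; ring
  have e2 : ∑ i ∈ Finset.range n, (p * q).coeff i * ((b : ℝ)⁻¹) ^ i
      = ∑ i ∈ Finset.range n, convCoeff c c' i * ((b : ℝ)⁻¹) ^ i := by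
    refine Finset.sum_congr rfl fun i hi => ?_
    have hi' := Finset.mem_range.1 hi
    rw [Polynomial.coeff_mul, Finset.Nat.sum_antidiagonal_eq_sum_range_succ_mk, convCoeff]
    congr 1
    refine Finset.sum_congr rfl fun j hj => ?_
    have hj' := Finset.mem_range.1 hj
    rw [hp, hq, coeff_sum_monomial (by omega), coeff_sum_monomial (by omega)]
  simp only
  rw [e2, Polynomial.eval_mul, hp, hq, eval_sum_monomial, eval_sum_monomial, e1, e1, e1, pow_add]
  ring

/-- The equation is not solved: proposed coefficients are checked against c = e + η * c
(convolution), since 1 - h can be divided out of the error. -/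
lemma HasTrunc.of_one_sub_mul {h g : ℕ → ℝ} {a n : ℕ} {e η c : ℕ → ℝ} (hh : HasTrunc h 0 n η)
    (hh1 : InvPowO 1 h) (hg : HasTrunc (fun b => (1 - h b) * g b) a n e)
    (hc : ∀ i < n, c i = e i + convCoeff η c i) : HasTrunc g a n c := by
  refine InvPowO.of_one_sub_mul hh1 ?_
  have hm := hh.mul (hasTrunc_self a n c)
  rw [zero_add] at hm
  have h1 := (hg.sub (hasTrunc_self a n c)).add hm
  have h2 := hasTrunc_zero_iff.1 (h1.congr_coeff (c' := fun _ => 0) fun i hi => by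
    rw [hc i hi]
    ring)
  exact h2.congr (Eventually.of_forall fun b => by ring)

lemma HasTrunc.comp_mul {g : ℕ → ℝ} {a n : ℕ} {c : ℕ → ℝ} (hg : HasTrunc g a n c) {r : ℕ}
    (hr : 0 < r) : HasTrunc (fun b => g (r * b)) a n fun i => c i * ((r : ℝ)⁻¹) ^ (a + i) := by
  have h1 := IsBigO.comp_tendsto hg (tendsto_mul_left_atTop_nat hr)
  have h2 : InvPowO 1 fun b => ((r * b : ℕ) : ℝ)⁻¹ :=
    ((invPowO_pow 1).const_mul ((r : ℝ)⁻¹)).congr (Eventually.of_forall fun b => by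
      simp [mul_comm])
  refine InvPowO.congr (IsBigO.trans h1 (h2.pow_self (a + n))) (Eventually.of_forall fun b => ?_)
  simp only [Function.comp_apply, Nat.cast_mul, mul_inv, mul_pow]
  congr 1
  exact Finset.sum_congr rfl fun i _ => by ring

lemma hasTrunc_of_eq {g : ℕ → ℝ} {a n : ℕ} {c : ℕ → ℝ} (h : ∀ᶠ b : ℕ in atTop, g b =
    ∑ i ∈ Finset.range n, c i * ((b : ℝ)⁻¹) ^ (a + i)) : HasTrunc g a n c :=
  (hasTrunc_self a n c).congr (h.mono fun _ hb => hb.symm)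

/-! ### Low order expansions of the power sums -/

lemma invPowO_succ_inv_pow (n : ℕ) : InvPowO n fun k => (((k + 1 : ℕ) : ℝ)⁻¹) ^ n := by
  refine InvPowO.of_bound 1 (K := 1) fun k hk => ?_
  have hk0 : (0 : ℝ) < k := by exact_mod_cast hk
  rw [one_mul, abs_of_nonneg (by positivity)]
  gcongr
  exact_mod_cast Nat.le_succ k

lemma tendsto_inv_pow_nat {n : ℕ} (hn : n ≠ 0) :
    Tendsto (fun k : ℕ => ((k : ℝ)⁻¹) ^ n) atTop (nhds 0) := by
  simpa [zero_pow hn] using (tendsto_inv_atTop_nhds_zero_nat (𝕜 := ℝ)).pow n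

/-- The Euler–Maclaurin terms leave the exact defect -1/(6 k^3 (k+1)^3), of order 6; hence the
fourth coefficient is known to be 0. -/
lemma hasTrunc_zetaTail_two : HasTrunc (zetaTail 2) 1 4 (listCoeff [1, 1 / 2, 1 / 6, 0]) := by
  have h := zetaTail_sub_approx (s := 2) (q := 5) le_rfl (by norm_num)
    (F := fun n : ℕ => ((n : ℝ)⁻¹) ^ 1 + 1 / 2 * ((n : ℝ)⁻¹) ^ 2 + 1 / 6 * ((n : ℝ)⁻¹) ^ 3) (by
      have h0 := ((tendsto_inv_pow_nat (by norm_num : 1 ≠ 0)).add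
        ((tendsto_inv_pow_nat (by norm_num : 2 ≠ 0)).const_mul (1 / 2))).add
        ((tendsto_inv_pow_nat (by norm_num : 3 ≠ 0)).const_mul (1 / 6))
      simp only [mul_zero, add_zero] at h0
      exact h0) (by
      refine (((invPowO_pow 3).mul (invPowO_succ_inv_pow 3)).const_mul (-1 / 6)).congr ?_
      filter_upwards [eventually_ge_atTop 1] with k hk
      have hk0 : (k : ℝ) ≠ 0 := by
        have : k ≠ 0 := by omega
        exact_mod_cast this
      push_cast
      field_simp
      ring)
  refine InvPowO.congr h (Eventually.of_forall fun b => ?_)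
  simp [listCoeff, Finset.sum_range_succ]

lemma hasTrunc_zetaTail_three : HasTrunc (zetaTail 3) 2 2 (listCoeff [1 / 2, 1 / 2]) := by
  have h := zetaTail_sub_approx (s := 3) (q := 4) (by norm_num) (by norm_num)
    (F := fun n : ℕ => 1 / 2 * ((n : ℝ)⁻¹) ^ 2 + 1 / 2 * ((n : ℝ)⁻¹) ^ 3) (by
      have h0 := ((tendsto_inv_pow_nat (by norm_num : 2 ≠ 0)).const_mul (1 / 2)).add
        ((tendsto_inv_pow_nat (by norm_num : 3 ≠ 0)).const_mul (1 / 2))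
      simp only [mul_zero, add_zero] at h0
      exact h0) (by
      refine ((((invPowO_pow 2).mul (invPowO_succ_inv_pow 3)).add
        ((invPowO_pow 3).mul (invPowO_succ_inv_pow 2))).const_mul (1 / 2)).congr ?_
      filter_upwards [eventually_ge_atTop 1] with k hk
      have hk0 : (k : ℝ) ≠ 0 := by
        have : k ≠ 0 := by omega
        exact_mod_cast this
      push_cast
      field_simp
      ring)
  refine InvPowO.congr h (Eventually.of_forall fun b => ?_)
  simp [listCoeff, Finset.sum_range_succ]

lemma hasTrunc_zetaTail_four : HasTrunc (zetaTail 4) 3 1 (listCoeff [1 / 3]) := by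
  have h := zetaTail_sub_approx (s := 4) (q := 4) (by norm_num) (by norm_num)
    (F := fun n : ℕ => 1 / 3 * ((n : ℝ)⁻¹) ^ 3) (by
      have h0 := (tendsto_inv_pow_nat (by norm_num : 3 ≠ 0)).const_mul (1 / 3)
      simp only [mul_zero] at h0
      exact h0) (by
      refine (((((invPowO_pow 2).mul (invPowO_succ_inv_pow 3)).const_mul 2).add
        ((((invPowO_pow 3).mul (invPowO_succ_inv_pow 3)).const_mul (8 / 3)).mono (by norm_num))).add
        (((invPowO_pow 4).mul (invPowO_succ_inv_pow 3)).mono (by norm_num))).congr ?_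
      filter_upwards [eventually_ge_atTop 1] with k hk
      have hk0 : (k : ℝ) ≠ 0 := by
        have : k ≠ 0 := by omega
        exact_mod_cast this
      push_cast
      field_simp
      ring)
  refine InvPowO.congr h (Eventually.of_forall fun b => ?_)
  simp [listCoeff]

lemma hasTrunc_pairSum_two : HasTrunc (pairSum 2) 1 2 (listCoeff [1, -1 / 2]) := by
  have h1 : HasTrunc (fun b => zetaTail 2 (b ^ 2)) 1 2 (listCoeff [0, 1]) := by
    have h := IsBigO.comp_tendsto (hasTrunc_zetaTail_two.of_le (by norm_num : 1 ≤ 4))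
      (tendsto_pow_atTop (α := ℕ) (by norm_num : (2 : ℕ) ≠ 0))
    have h2 : InvPowO 4 fun b => zetaTail 2 (b ^ 2) - ((b : ℝ)⁻¹) ^ 2 := by
      have hO : InvPowO 4 ((fun b : ℕ => ((b : ℝ)⁻¹) ^ (1 + 1)) ∘ fun x : ℕ => x ^ 2) :=
        (invPowO_pow 4).congr (Eventually.of_forall fun b => by simp [← pow_mul])
      refine InvPowO.congr (IsBigO.trans h hO) (Eventually.of_forall fun b => ?_)
      simp [listCoeff]
    refine InvPowO.congr (h2.mono (by norm_num)) (Eventually.of_forall fun b => ?_)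
    simp [listCoeff, Finset.sum_range_succ]
  refine ((((hasTrunc_zetaTail_two.of_le (by norm_num : 2 ≤ 4)).sub h1).congr ?_).congr_coeff ?_)
  · filter_upwards [eventually_ge_atTop 1] with b hb
    rw [pairSum_eq le_rfl hb]
  · intro i hi
    interval_cases i <;> norm_num [listCoeff]

lemma HasTrunc.rowSum {d s a n : ℕ} {c : ℕ → ℝ} (hd : 0 < d) (hs : 2 ≤ s)
    (h : HasTrunc (zetaTail s) a n c) : HasTrunc (rowSum d s) a n
      fun i => c i * (((d : ℝ)⁻¹) ^ (a + i) - (((d : ℝ) + 1)⁻¹) ^ (a + i)) := by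
  refine (((h.comp_mul hd).sub (h.comp_mul (Nat.succ_pos d))).congr
    (Eventually.of_forall fun b => (rowSum_eq d b hs).symm)).congr_coeff fun i _ => ?_
  push_cast
  ring

lemma invPowO_colSum (d : ℕ) {s : ℕ} (hs : 2 ≤ s) : InvPowO s (colSum d s) := by
  have := colSum_approx d (J := 0) (n := 0) hs (fun _ => 0) 1 (fun x hx => by
    have h0 : 0 ≤ (1 + x)⁻¹ := by have := hx.1; positivity
    have h1 : (1 + x)⁻¹ ≤ 1 := inv_le_one_of_one_le₀ (by linarith [hx.1])
    simp only [Finset.range_zero, Finset.sum_empty, sub_zero, pow_zero, mul_one]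
    rw [abs_of_nonneg (by positivity)]
    exact pow_le_one₀ h0 h1)
  simpa using this

lemma invPowO_pairSum {s : ℕ} (hs : 2 ≤ s) : InvPowO (s - 1) (pairSum s) := by
  have h1 := zetaTail_invPowO hs
  have h2 : InvPowO (s - 1) fun b => zetaTail s (b ^ 2) := by
    have h3 := IsBigO.comp_tendsto h1 (tendsto_pow_atTop (α := ℕ) (by norm_num : (2 : ℕ) ≠ 0))
    have h4 : InvPowO 1 fun b => ((b ^ 2 : ℕ) : ℝ)⁻¹ :=
      ((invPowO_pow 2).mono (by norm_num)).congr (Eventually.of_forall fun b => by simp)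
    exact IsBigO.trans h3 (h4.pow_self (s - 1))
  refine (h1.sub h2).congr ?_
  filter_upwards [eventually_ge_atTop 1] with b hb
  rw [pairSum_eq hs hb]

lemma invPowO_rowSum {d s : ℕ} (hd : 0 < d) (hs : 2 ≤ s) : InvPowO (s - 1) (rowSum d s) := by
  have h : HasTrunc (zetaTail s) (s - 1) 0 (fun _ => 0) :=
    hasTrunc_zero_iff.2 (zetaTail_invPowO hs)
  exact (h.rowSum hd hs).invPowO

lemma invPowO_cornerTerm (d s : ℕ) : InvPowO s (cornerTerm d s) := by
  refine (((invPowO_pow s).mul ((hasInvExpansion_succ_ratio.pow s).bounded)).const_mul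
    (((d : ℝ)⁻¹) ^ s)).congr ?_
  filter_upwards [eventually_ge_atTop 1] with b hb
  rw [cornerTerm_eq d s hb]

/-- The coefficients 1, -2, 3 are those of (1+x)^(-2), with remainder constant 7 ≥ 4 + 3x. The terms
-1 and -1/2 come from the tail of ζ(2); the tails of ζ(3) and ζ(4) fall below the precision. -/
lemma hasTrunc_colSum_two (d : ℕ) : HasTrunc (colSum d 2) 1 4
    (listCoeff [0, zetaReal 2, -1 - 2 * d * zetaReal 3, -1 / 2 + 3 * d ^ 2 * zetaReal 4]) := by
  have h := colSum_approx d (s := 2) (J := 3) (n := 3) le_rfl (listCoeff [1, -2, 3]) 7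
    (fun x hx => by
      have h1 : 0 < 1 + x := by linarith [hx.1]
      have e : ((1 + x)⁻¹) ^ 2 - ∑ i ∈ Finset.range 3, listCoeff [1, -2, 3] i * x ^ i
          = -((4 + 3 * x) * x ^ 3 * ((1 + x)⁻¹) ^ 2) := by
        simp [listCoeff, Finset.sum_range_succ]
        field_simp
        ring
      have h2 : ((1 + x)⁻¹) ^ 2 ≤ 1 :=
        pow_le_one₀ (by positivity) (inv_le_one_of_one_le₀ (by linarith [hx.1]))
      have h3 : 0 ≤ x ^ 3 := pow_nonneg hx.1 3
      have h4 : 0 ≤ 4 + 3 * x := by linarith [hx.1]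
      rw [e, abs_neg, abs_of_nonneg (by positivity)]
      calc _ ≤ (4 + 3 * x) * x ^ 3 * 1 := by gcongr
        _ ≤ 7 * x ^ 3 := by rw [mul_one]; gcongr; linarith [hx.2])
  have h1 : InvPowO 5 fun b => ((b : ℝ)⁻¹) ^ 2
      * (zetaTail 2 b - (((b : ℝ)⁻¹) + 1 / 2 * ((b : ℝ)⁻¹) ^ 2)) := by
    refine (invPowO_pow 2).mul (N := 3) (InvPowO.congr (hasTrunc_zetaTail_two.of_le
      (by norm_num : 2 ≤ 4)) (Eventually.of_forall fun b => ?_))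
    simp [listCoeff, Finset.sum_range_succ]
  have h2 : InvPowO 5 fun b => ((b : ℝ)⁻¹) ^ 3 * zetaTail 3 b :=
    (invPowO_pow 3).mul (zetaTail_invPowO (by norm_num))
  have h3 : InvPowO 5 fun b => ((b : ℝ)⁻¹) ^ 4 * zetaTail 4 b :=
    ((invPowO_pow 4).mul (zetaTail_invPowO (by norm_num))).mono (by norm_num)
  refine InvPowO.congr (((h.sub h1).add (h2.const_mul (2 * d))).sub (h3.const_mul (3 * d ^ 2)))
    (Eventually.of_forall fun b => ?_)
  simp [listCoeff, Finset.sum_range_succ]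
  ring

lemma hasTrunc_colSum_three (d : ℕ) : HasTrunc (colSum d 3) 2 2 (listCoeff [0, zetaReal 3]) := by
  have h := colSum_approx d (s := 3) (J := 1) (n := 1) (by norm_num) (listCoeff [1]) 7
    (fun x hx => by
      have h1 : 0 < 1 + x := by linarith [hx.1]
      have e : ((1 + x)⁻¹) ^ 3 - ∑ i ∈ Finset.range 1, listCoeff [1] i * x ^ i
          = -((3 + 3 * x + x ^ 2) * x * ((1 + x)⁻¹) ^ 3) := by
        simp [listCoeff]
        field_simp
        ring
      have h2 : ((1 + x)⁻¹) ^ 3 ≤ 1 :=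
        pow_le_one₀ (by positivity) (inv_le_one_of_one_le₀ (by linarith [hx.1]))
      have h3 : 0 ≤ x := hx.1
      rw [e, abs_neg, abs_of_nonneg (by positivity), pow_one]
      calc _ ≤ (3 + 3 * x + x ^ 2) * x * 1 := by gcongr
        _ ≤ 7 * x := by rw [mul_one]; gcongr; nlinarith [hx.2])
  have h2 : InvPowO 4 fun b => ((b : ℝ)⁻¹) ^ 3 * zetaTail 3 b :=
    ((invPowO_pow 3).mul (zetaTail_invPowO (by norm_num))).mono (by norm_num)
  refine InvPowO.congr (h.sub h2) (Eventually.of_forall fun b => ?_)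
  simp [listCoeff, Finset.sum_range_succ]
  ring

lemma hasTrunc_succ_ratio : HasTrunc (fun b => (1 + (b : ℝ)⁻¹)⁻¹) 0 5
    (listCoeff [1, -1, 1, -1, 1]) := by
  have hO : InvPowO 1 fun n => -1 * (n : ℝ)⁻¹ := by simpa using (invPowO_pow 1).const_mul (-1)
  refine HasTrunc.of_one_sub_mul (h := fun n => -1 * (n : ℝ)⁻¹) (η := listCoeff [0, -1])
    (e := listCoeff [1]) (hasTrunc_of_eq (Eventually.of_forall fun b => ?_)) hO
    (hasTrunc_of_eq (Eventually.of_forall fun b => ?_)) ?_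
  · simp [listCoeff, Finset.sum_range_succ]
  · have : (1 + (b : ℝ)⁻¹) ≠ 0 := by positivity
    simp [listCoeff, Finset.sum_range_succ, this]
  · intro i hi
    interval_cases i <;> norm_num [listCoeff, convCoeff, Finset.sum_range_succ]

lemma HasTrunc.cornerTerm {s n : ℕ} {c : ℕ → ℝ} (d : ℕ)
    (h : HasTrunc (fun b => ((1 + (b : ℝ)⁻¹)⁻¹) ^ s) 0 n c) :
    HasTrunc (cornerTerm d s) s n fun i => ((d : ℝ)⁻¹) ^ s * c i := by
  have h1 : HasTrunc (fun b : ℕ => ((b : ℝ)⁻¹) ^ s * ((1 + (b : ℝ)⁻¹)⁻¹) ^ s) s n c := by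
    have h' := h
    simp only [HasTrunc, zero_add] at h'
    refine InvPowO.congr ((invPowO_pow s).mul h') (Eventually.of_forall fun b => ?_)
    simp only [mul_sub, Finset.mul_sum]
    congr 1
    exact Finset.sum_congr rfl fun i _ => by rw [pow_add]; ring
  refine (h1.const_mul (((d : ℝ)⁻¹) ^ s)).congr ?_
  filter_upwards [eventually_ge_atTop 1] with b hb
  rw [cornerTerm_eq d s hb]

lemma hasTrunc_succ_ratio_two : HasTrunc (fun b => ((1 + (b : ℝ)⁻¹)⁻¹) ^ 2) 0 5
    (listCoeff [1, -2, 3, -4, 5]) := by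
  simp only [sq]
  refine (hasTrunc_succ_ratio.mul hasTrunc_succ_ratio).congr_coeff fun i hi => ?_
  interval_cases i <;> norm_num [listCoeff, convCoeff, Finset.sum_range_succ]

lemma hasTrunc_succ_ratio_three : HasTrunc (fun b => ((1 + (b : ℝ)⁻¹)⁻¹) ^ 3) 0 3
    (listCoeff [1, -3, 6]) := by
  simp only [pow_succ _ 2]
  refine ((hasTrunc_succ_ratio_two.mul hasTrunc_succ_ratio).of_le (by norm_num)).congr_coeff
    fun i hi => ?_
  interval_cases i <;> norm_num [listCoeff, convCoeff, Finset.sum_range_succ]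

lemma hasTrunc_succ_ratio_four : HasTrunc (fun b => ((1 + (b : ℝ)⁻¹)⁻¹) ^ 4) 0 2
    (listCoeff [1, -4]) := by
  simp only [pow_succ _ 3]
  refine ((hasTrunc_succ_ratio_three.of_le (by norm_num : 2 ≤ 3)).mul
    (hasTrunc_succ_ratio.of_le (by norm_num : 2 ≤ 5))).congr_coeff fun i hi => ?_
  interval_cases i <;> norm_num [listCoeff, convCoeff, Finset.sum_range_succ]

lemma hasTrunc_succ_ratio_five : HasTrunc (fun b => ((1 + (b : ℝ)⁻¹)⁻¹) ^ 5) 0 1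
    (listCoeff [1]) := by
  simp only [pow_succ _ 4]
  refine ((hasTrunc_succ_ratio_four.of_le (by norm_num : 1 ≤ 2)).mul
    (hasTrunc_succ_ratio.of_le (by norm_num : 1 ≤ 5))).congr_coeff fun i hi => ?_
  interval_cases i <;> norm_num [listCoeff, convCoeff, Finset.sum_range_succ]

/-! ### Low order expansions of the moments -/

lemma HasTrunc.pow_mul {g : ℕ → ℝ} {a n : ℕ} {c : ℕ → ℝ} (k : ℕ) (hg : HasTrunc g a n c) :
    HasTrunc (fun b => ((b : ℝ)⁻¹) ^ k * g b) (k + a) n c := by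
  refine InvPowO.congr (((invPowO_pow k).mul hg).mono (by omega))
    (Eventually.of_forall fun b => ?_)
  simp only [mul_sub, Finset.mul_sum]
  congr 1
  exact Finset.sum_congr rfl fun i _ => by ring

lemma hasTrunc_pow_sub (m n : ℕ) :
    HasTrunc (fun b : ℕ => ((b : ℝ)⁻¹) ^ m - ((b : ℝ)⁻¹) ^ (m + 1)) 0 n
      fun i => (if i = m then 1 else 0) - if i = m + 1 then 1 else 0 := by
  have h := eval_trunc_invPowO (Polynomial.X ^ m - Polynomial.X ^ (m + 1)) n
  simp only [Polynomial.coeff_sub, Polynomial.coeff_X_pow, Polynomial.eval_sub,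
    Polynomial.eval_pow, Polynomial.eval_X] at h
  simpa only [HasTrunc, zero_add] using h

lemma HasTrunc.of_moment_rec {g R : ℕ → ℝ} {m a n : ℕ} {e c : ℕ → ℝ} (hm : 1 ≤ m)
    (hR : HasTrunc R a n e)
    (h : ∀ᶠ b : ℕ in atTop, (1 - (((b : ℝ)⁻¹) ^ m - ((b : ℝ)⁻¹) ^ (m + 1))) * g b = R b)
    (hc : ∀ i < n, c i = e i
      + convCoeff (fun i => (if i = m then 1 else 0) - if i = m + 1 then 1 else 0) c i) :
    HasTrunc g a n c :=
  HasTrunc.of_one_sub_mul (hasTrunc_pow_sub m n) (invPowO_pow_sub hm)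
    (hR.congr (h.mono fun _ hb => hb.symm)) hc

lemma sum_range_cast (b : ℕ) : ∑ a ∈ Finset.range b, (a : ℝ) = b * (b - 1) / 2 := by
  induction b with
  | zero => simp
  | succ b ih => rw [Finset.sum_range_succ, ih]; push_cast; ring

lemma sum_range_cast_sq (b : ℕ) :
    ∑ a ∈ Finset.range b, (a : ℝ) ^ 2 = b * (b - 1) * (2 * b - 1) / 6 := by
  induction b with
  | zero => simp
  | succ b ih => rw [Finset.sum_range_succ, ih]; push_cast; ring

lemma sum_range_cast_cube (b : ℕ) :
    ∑ a ∈ Finset.range b, (a : ℝ) ^ 3 = b ^ 2 * (b - 1) ^ 2 / 4 := by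
  induction b with
  | zero => simp
  | succ b ih => rw [Finset.sum_range_succ, ih]; push_cast; ring

lemma hasTrunc_powSum_one (d : ℕ) : HasTrunc (fun b : ℕ => ((b : ℝ)⁻¹) ^ 2
    * (∑ a ∈ Finset.range b, (a : ℝ)) - d * ((b : ℝ)⁻¹) ^ 2) 0 3
    (listCoeff [1 / 2, -1 / 2, -d]) := by
  refine hasTrunc_of_eq ?_
  filter_upwards [eventually_ge_atTop 1] with b hb
  have hb0 : (b : ℝ) ≠ 0 := by positivity
  rw [sum_range_cast]
  simp [listCoeff, Finset.sum_range_succ]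
  field_simp
  ring

lemma hasTrunc_powSum_two (d : ℕ) : HasTrunc (fun b : ℕ => ((b : ℝ)⁻¹) ^ 3
    * (∑ a ∈ Finset.range b, (a : ℝ) ^ 2) - d ^ 2 * ((b : ℝ)⁻¹) ^ 3) 0 4
    (listCoeff [1 / 3, -1 / 2, 1 / 6, -d ^ 2]) := by
  refine hasTrunc_of_eq ?_
  filter_upwards [eventually_ge_atTop 1] with b hb
  have hb0 : (b : ℝ) ≠ 0 := by positivity
  rw [sum_range_cast_sq]
  simp [listCoeff, Finset.sum_range_succ]
  field_simp
  ring

lemma hasTrunc_powSum_three (d : ℕ) : HasTrunc (fun b : ℕ => ((b : ℝ)⁻¹) ^ 4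
    * (∑ a ∈ Finset.range b, (a : ℝ) ^ 3) - d ^ 3 * ((b : ℝ)⁻¹) ^ 4) 0 5
    (listCoeff [1 / 4, -1 / 2, 1 / 4, 0, -d ^ 3]) := by
  refine hasTrunc_of_eq ?_
  filter_upwards [eventually_ge_atTop 1] with b hb
  have hb0 : (b : ℝ) ≠ 0 := by positivity
  rw [sum_range_cast_cube]
  simp [listCoeff, Finset.sum_range_succ]
  field_simp
  ring

lemma excessMoment_rec_one {b d : ℕ} (hdb : d < b) (k : ℕ) :
    (1 - (((b : ℝ)⁻¹) ^ 1 - ((b : ℝ)⁻¹) ^ (1 + 1))) * excessMoment d k 1 b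
      = momentSource d k 1 b := by
  rw [excessMoment_rec_inv hdb k le_rfl]
  simp

lemma excessMoment_rec_two {b d : ℕ} (hdb : d < b) (k : ℕ) :
    (1 - (((b : ℝ)⁻¹) ^ 2 - ((b : ℝ)⁻¹) ^ (2 + 1))) * excessMoment d k 2 b
      = 2 * ((((b : ℝ)⁻¹) ^ 2 * (∑ a ∈ Finset.range b, (a : ℝ)) - d * ((b : ℝ)⁻¹) ^ 2)
        * (((b : ℝ)⁻¹) ^ 1 * excessMoment d k 1 b)) + momentSource d k 2 b := by
  rw [excessMoment_rec_inv hdb k (by norm_num)]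
  norm_num
  ring

lemma excessMoment_rec_three {b d : ℕ} (hdb : d < b) (k : ℕ) :
    (1 - (((b : ℝ)⁻¹) ^ 3 - ((b : ℝ)⁻¹) ^ (3 + 1))) * excessMoment d k 3 b
      = 3 * ((((b : ℝ)⁻¹) ^ 2 * (∑ a ∈ Finset.range b, (a : ℝ)) - d * ((b : ℝ)⁻¹) ^ 2)
        * (((b : ℝ)⁻¹) ^ 2 * excessMoment d k 2 b))
      + 3 * ((((b : ℝ)⁻¹) ^ 3 * (∑ a ∈ Finset.range b, (a : ℝ) ^ 2) - d ^ 2 * ((b : ℝ)⁻¹) ^ 3)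
        * (((b : ℝ)⁻¹) ^ 1 * excessMoment d k 1 b)) + momentSource d k 3 b := by
  rw [excessMoment_rec_inv hdb k (by norm_num)]
  norm_num [Finset.sum_Ico_eq_sum_range, Finset.sum_range_succ, Nat.choose]
  ring

lemma excessMoment_rec_four {b d : ℕ} (hdb : d < b) (k : ℕ) :
    (1 - (((b : ℝ)⁻¹) ^ 4 - ((b : ℝ)⁻¹) ^ (4 + 1))) * excessMoment d k 4 b
      = 4 * ((((b : ℝ)⁻¹) ^ 2 * (∑ a ∈ Finset.range b, (a : ℝ)) - d * ((b : ℝ)⁻¹) ^ 2)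
        * (((b : ℝ)⁻¹) ^ 3 * excessMoment d k 3 b))
      + 6 * ((((b : ℝ)⁻¹) ^ 3 * (∑ a ∈ Finset.range b, (a : ℝ) ^ 2) - d ^ 2 * ((b : ℝ)⁻¹) ^ 3)
        * (((b : ℝ)⁻¹) ^ 2 * excessMoment d k 2 b))
      + 4 * ((((b : ℝ)⁻¹) ^ 4 * (∑ a ∈ Finset.range b, (a : ℝ) ^ 3) - d ^ 3 * ((b : ℝ)⁻¹) ^ 4)
        * (((b : ℝ)⁻¹) ^ 1 * excessMoment d k 1 b)) + momentSource d k 4 b := by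
  rw [excessMoment_rec_inv hdb k (by norm_num)]
  norm_num [Finset.sum_Ico_eq_sum_range, Finset.sum_range_succ, Nat.choose]
  ring

lemma momentSource_succ_one {b d : ℕ} (hdb : d < b) (k : ℕ) :
    momentSource d (k + 1) 1 b = ((b : ℝ)⁻¹) ^ 2 * excessMoment d k 1 b := by
  simp [momentSource, Finset.sum_range_succ, excessMoment_zero hdb]

lemma momentSource_succ_two {b d : ℕ} (hdb : d < b) (k : ℕ) :
    momentSource d (k + 1) 2 b
      = ((b : ℝ)⁻¹) ^ 3 * (excessMoment d k 2 b + 2 * d * excessMoment d k 1 b) := by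
  simp [momentSource, Finset.sum_range_succ, excessMoment_zero hdb]

lemma hasTrunc_momentSource_zero (d m : ℕ) {n : ℕ} (hn : 1 ≤ n) :
    HasTrunc (momentSource d 0 m) m n (listCoeff [sourceCoeff d m]) := by
  refine hasTrunc_of_eq ?_
  filter_upwards [eventually_ge_atTop 1] with b hb
  obtain ⟨n, rfl⟩ := Nat.exists_eq_add_of_le' hn
  rw [momentSource_zero d m hb, Finset.sum_range_succ']
  simp [listCoeff]

lemma sourceCoeff_one (d : ℕ) : sourceCoeff d 1 = -((d : ℝ) + 1 / 2) := by
  norm_num [sourceCoeff, Finset.sum_range_succ]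
  ring

lemma sourceCoeff_two (d : ℕ) : sourceCoeff d 2 = -(1 / 3 + d + (d : ℝ) ^ 2) := by
  norm_num [sourceCoeff, Finset.sum_range_succ]
  ring

lemma sourceCoeff_three (d : ℕ) :
    sourceCoeff d 3 = -(1 / 4 + d + 3 / 2 * (d : ℝ) ^ 2 + (d : ℝ) ^ 3) := by
  norm_num [sourceCoeff, Finset.sum_range_succ, Nat.choose]
  ring

/-- With x = 1/b the first moment is -h x/(1 - x + x^2), and 1/(1 - x + x^2) = (1 + x)/(1 + x^3).
For k = 1 and k = 2 the second and third powers of this factor appear. -/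
lemma hasTrunc_moment_zero_one (d : ℕ) {h : ℝ} (hh : h = d + 1 / 2) :
    HasTrunc (excessMoment d 0 1) 1 5 (listCoeff [-h, -h, 0, h, h]) := by
  refine HasTrunc.of_moment_rec le_rfl (hasTrunc_momentSource_zero d 1 (by norm_num : 1 ≤ 5))
    ((eventually_gt_atTop d).mono fun b hb => excessMoment_rec_one hb 0) fun i hi => ?_
  rw [sourceCoeff_one, ← hh]
  interval_cases i <;> simp [listCoeff, convCoeff, Finset.sum_range_succ]

lemma hasTrunc_moment_zero_two (d : ℕ) {h K : ℝ} (hh : h = d + 1 / 2)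
    (hK : K = 1 / 3 + d + (d : ℝ) ^ 2) :
    HasTrunc (excessMoment d 0 2) 2 3 (listCoeff [-h - K, 0, 2 * h ^ 2 - h - K]) := by
  have h1 := (((hasTrunc_powSum_one d).mul
    ((hasTrunc_moment_zero_one d hh).of_le (by norm_num : 3 ≤ 5) |>.pow_mul 1)).const_mul 2).add
    (hasTrunc_momentSource_zero d 2 (by norm_num : 1 ≤ 3))
  refine HasTrunc.of_moment_rec (by norm_num) h1
    ((eventually_gt_atTop d).mono fun b hb => excessMoment_rec_two hb 0) fun i hi => ?_
  rw [sourceCoeff_two, ← hK]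
  interval_cases i <;> simp [listCoeff, convCoeff, Finset.sum_range_succ] <;> rw [hh] <;> ring

lemma hasTrunc_moment_zero_three (d : ℕ) {h : ℝ} (hh : h = d + 1 / 2) :
    HasTrunc (excessMoment d 0 3) 2 2 (listCoeff [-h, -(d * (d + 1) * h)]) := by
  -- At the precision b^(-4) the second moment enters only through its order.
  have h1 : InvPowO 4 fun b => ((b : ℝ)⁻¹) ^ 2 * excessMoment d 0 2 b :=
    (invPowO_pow 2).mul (invPowO_excessMoment_of_two_le d 0 le_rfl)
  have h2 := ((((hasTrunc_powSum_one d).of_le (by norm_num : 2 ≤ 3)).mul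
    (h1.hasTrunc (a := 2) (n := 2) le_rfl)).const_mul 3).add
    ((((hasTrunc_powSum_two d).of_le (by norm_num : 2 ≤ 4)).mul
    ((hasTrunc_moment_zero_one d hh).of_le (by norm_num : 2 ≤ 5) |>.pow_mul 1)).const_mul 3)
  have h3 := h2.add ((hasTrunc_momentSource_zero d 3 le_rfl).shift (by norm_num : 2 + 1 = 3))
  refine HasTrunc.of_moment_rec (by norm_num) h3
    ((eventually_gt_atTop d).mono fun b hb => excessMoment_rec_three hb 0) fun i hi => ?_
  rw [sourceCoeff_three]
  interval_cases i <;> simp [listCoeff, convCoeff, Finset.sum_range_succ] <;> rw [hh] <;> ring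

lemma hasTrunc_moment_zero_four (d : ℕ) {h : ℝ} (hh : h = d + 1 / 2) :
    HasTrunc (excessMoment d 0 4) 2 1 (listCoeff [-h]) := by
  have h1 : InvPowO 3 fun b => ((b : ℝ)⁻¹) ^ 2 * excessMoment d 0 2 b :=
    ((invPowO_pow 2).mul (invPowO_excessMoment d 0 2))
  have h1' : InvPowO 3 fun b => ((b : ℝ)⁻¹) ^ 3 * excessMoment d 0 3 b :=
    ((invPowO_pow 3).mul (invPowO_excessMoment d 0 3)).mono (by norm_num)
  have h2 := (((((hasTrunc_powSum_one d).of_le (by norm_num : 1 ≤ 3)).mul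
    (h1'.hasTrunc (a := 2) (n := 1) le_rfl)).const_mul 4).add
    ((((hasTrunc_powSum_two d).of_le (by norm_num : 1 ≤ 4)).mul
    (h1.hasTrunc (a := 2) (n := 1) le_rfl)).const_mul 6)).add
    ((((hasTrunc_powSum_three d).of_le (by norm_num : 1 ≤ 5)).mul
    ((hasTrunc_moment_zero_one d hh).of_le (by norm_num : 1 ≤ 5) |>.pow_mul 1)).const_mul 4)
  have h3 := h2.add ((invPowO_momentSource d 0 4).hasTrunc (a := 2) (n := 1) (by norm_num))
  refine HasTrunc.of_moment_rec (by norm_num) h3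
    ((eventually_gt_atTop d).mono fun b hb => excessMoment_rec_four hb 0) fun i hi => ?_
  interval_cases i
  simp [listCoeff, convCoeff]

lemma hasTrunc_moment_one_one (d : ℕ) {h : ℝ} (hh : h = d + 1 / 2) :
    HasTrunc (excessMoment d 1 1) 3 4 (listCoeff [-h, -2 * h, -h, 2 * h]) := by
  refine HasTrunc.of_moment_rec le_rfl
    (((hasTrunc_moment_zero_one d hh).of_le (by norm_num : 4 ≤ 5)).pow_mul 2)
    ((eventually_gt_atTop d).mono fun b hb => ?_) fun i hi => ?_
  · exact (excessMoment_rec_one hb 1).trans (momentSource_succ_one hb 0)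
  · interval_cases i <;> simp [listCoeff, convCoeff, Finset.sum_range_succ] <;> ring

lemma hasTrunc_moment_two_one (d : ℕ) {h : ℝ} (hh : h = d + 1 / 2) :
    HasTrunc (excessMoment d 2 1) 5 2 (listCoeff [-h, -3 * h]) := by
  refine HasTrunc.of_moment_rec le_rfl
    (((hasTrunc_moment_one_one d hh).of_le (by norm_num : 2 ≤ 4)).pow_mul 2)
    ((eventually_gt_atTop d).mono fun b hb => ?_) fun i hi => ?_
  · exact (excessMoment_rec_one hb 2).trans (momentSource_succ_one hb 1)
  · interval_cases i <;> simp [listCoeff, convCoeff, Finset.sum_range_succ] <;> ring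

lemma hasTrunc_moment_one_two (d : ℕ) {h K : ℝ} (hh : h = d + 1 / 2)
    (hK : K = 1 / 3 + d + (d : ℝ) ^ 2) :
    HasTrunc (excessMoment d 1 2) 4 2 (listCoeff [-2 * h ^ 2, -2 * h ^ 2 - h - K]) := by
  have h1 := (((hasTrunc_powSum_one d).of_le (by norm_num : 2 ≤ 3)).mul
    ((hasTrunc_moment_one_one d hh).of_le (by norm_num : 2 ≤ 4) |>.pow_mul 1)).const_mul 2
  have h2 := ((((hasTrunc_moment_zero_two d hh hK).of_le (by norm_num : 1 ≤ 3)).shift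
    (by norm_num : 1 + 1 = 2)).add (((hasTrunc_moment_zero_one d hh).of_le
    (by norm_num : 2 ≤ 5)).const_mul (2 * d))).pow_mul 3
  refine HasTrunc.of_moment_rec (m := 2) (by norm_num) (h1.add h2)
    ((eventually_gt_atTop d).mono fun b hb => ?_) fun i hi => ?_
  · exact (excessMoment_rec_two hb 1).trans (congrArg _ (momentSource_succ_two hb 0))
  · interval_cases i <;> simp [listCoeff, convCoeff, Finset.sum_range_succ] <;> rw [hh] <;> ring

lemma hasTrunc_moment_one_three (d : ℕ) {h : ℝ} (hh : h = d + 1 / 2) :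
    HasTrunc (excessMoment d 1 3) 4 1 (listCoeff [-h]) := by
  have h1 : InvPowO 5 fun b => ((b : ℝ)⁻¹) ^ 2 * excessMoment d 1 2 b :=
    ((invPowO_pow 2).mul (invPowO_excessMoment d 1 2))
  have h2 := ((((hasTrunc_powSum_one d).of_le (by norm_num : 1 ≤ 3)).mul
    (h1.hasTrunc (a := 4) (n := 1) le_rfl)).const_mul 3).add
    ((((hasTrunc_powSum_two d).of_le (by norm_num : 1 ≤ 4)).mul
    ((hasTrunc_moment_one_one d hh).of_le (by norm_num : 1 ≤ 4) |>.pow_mul 1)).const_mul 3)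
  have h3 := h2.add ((invPowO_momentSource d 1 3).hasTrunc (a := 4) (n := 1) (by norm_num))
  refine HasTrunc.of_moment_rec (by norm_num) h3
    ((eventually_gt_atTop d).mono fun b hb => excessMoment_rec_three hb 1) fun i hi => ?_
  interval_cases i
  simp [listCoeff, convCoeff]

/-! ### Low order expansions of the moment terms -/

/-- The three products start at b^(-6), b^(-4) and b^(-3), which dictates how many terms of each
factor are kept. The α's are the coefficients of the row plus column sums. -/
lemma hasTrunc_momentTerm_one {d : ℕ} (hd : 0 < d) {h u w : ℝ} (hh : h = d + 1 / 2)
    (hu : u = (d : ℝ)⁻¹) (hw : w = ((d : ℝ) + 1)⁻¹) {α₁ α₂ α₃ α₄ : ℝ} (h₁ : α₁ = u - w)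
    (h₂ : α₂ = (u ^ 2 - w ^ 2) / 2 + zetaReal 2)
    (h₃ : α₃ = (u ^ 3 - w ^ 3) / 6 - 1 - 2 * d * zetaReal 3)
    (h₄ : α₄ = -1 / 2 + 3 * d ^ 2 * zetaReal 4) :
    HasTrunc (momentTerm d 1) 3 5 (listCoeff [h * u ^ 2, h * (-u ^ 2 + α₁),
      h * (-u ^ 2 + α₂ + 2 * α₁), h * (-2 * u ^ 2 + α₃ + 2 * α₂ + 1),
      h * (3 * u ^ 2 + α₄ + 2 * α₃ - 5 * α₁ + 5 / 2)]) := by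
  have v0 := hasTrunc_moment_zero_one d hh
  have v1 := hasTrunc_moment_one_one d hh
  have v2 := hasTrunc_moment_two_one d hh
  have hα : HasTrunc (fun b => rowSum d 2 b + colSum d 2 b) 1 4 (listCoeff [α₁, α₂, α₃, α₄]) := by
    refine ((hasTrunc_zetaTail_two.rowSum hd le_rfl).add (hasTrunc_colSum_two d)).congr_coeff
      fun i hi => ?_
    rw [h₁, h₂, h₃, h₄, hu, hw]
    interval_cases i <;> simp [listCoeff] <;> ring
  have hD := hasTrunc_succ_ratio_two.cornerTerm d
  have t1 := (v2.mul hasTrunc_pairSum_two).shift (by norm_num : 3 + 3 = 6)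
  have t2 := ((v1.sub (v2.shift (by norm_num : 3 + 2 = 5))).mul hα).shift (by norm_num : 3 + 1 = 4)
  have t3 := ((v0.sub (((v1.of_le (by norm_num : 3 ≤ 4)).shift
    (by norm_num : 1 + 2 = 3)).const_mul 2)).add ((v2.of_le (by norm_num : 1 ≤ 2)).shift
    (by norm_num : 1 + 4 = 5))).mul hD
  refine (((t1.add t2).add t3).const_mul ((-1) ^ 1)).congr_coeff fun i hi => ?_
  rw [← hu]
  clear h₁ h₂ h₃ h₄
  interval_cases i <;> simp [listCoeff, convCoeff, Finset.sum_range_succ] <;> ring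

/-- The pair sum product is already O(b^(-8)); the others start at b^(-6) and b^(-5). -/
lemma hasTrunc_momentTerm_two {d : ℕ} (hd : 0 < d) {h K u w : ℝ} (hh : h = d + 1 / 2)
    (hK : K = 1 / 3 + d + (d : ℝ) ^ 2) (hu : u = (d : ℝ)⁻¹) (hw : w = ((d : ℝ) + 1)⁻¹)
    {β₁ β₂ : ℝ} (h₁ : β₁ = (u ^ 2 - w ^ 2) / 2) (h₂ : β₂ = (u ^ 3 - w ^ 3) / 2 + zetaReal 3) :
    HasTrunc (momentTerm d 2) 3 5 (listCoeff [0, 0, -(u ^ 3 * (h + K)),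
      3 * u ^ 3 * (h + K) - 2 * h ^ 2 * β₁,
      u ^ 3 * (6 * h ^ 2 - 7 * (h + K)) - 2 * h ^ 2 * β₂ - (2 * h ^ 2 + h + K) * β₁]) := by
  have v0 := hasTrunc_moment_zero_two d hh hK
  have v1 := hasTrunc_moment_one_two d hh hK
  have v2 : InvPowO 6 (excessMoment d 2 2) := invPowO_excessMoment_of_two_le d 2 le_rfl
  have hβ : HasTrunc (fun b => rowSum d 3 b + colSum d 3 b) 2 2 (listCoeff [β₁, β₂]) := by
    refine ((hasTrunc_zetaTail_three.rowSum hd (by norm_num)).add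
      (hasTrunc_colSum_three d)).congr_coeff fun i hi => ?_
    rw [h₁, h₂, hu, hw]
    interval_cases i <;> simp [listCoeff] <;> ring
  have hD := hasTrunc_succ_ratio_three.cornerTerm d
  have t1 := (v2.mul (invPowO_pairSum (by norm_num : 2 ≤ 3))).hasTrunc (a := 3) (n := 5) le_rfl
  have t2 := ((v1.sub (v2.hasTrunc (a := 4) (n := 2) le_rfl)).mul hβ).shift (by norm_num : 3 + 3 = 6)
  have t3 := (((v0.sub (((v1.of_le (by norm_num : 1 ≤ 2)).shift
    (by norm_num : 2 + 2 = 4)).const_mul 2)).add (v2.hasTrunc (a := 2) (n := 3)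
    (by norm_num))).mul hD).shift (by norm_num : 3 + 2 = 5)
  refine (((t1.add t2).add t3).const_mul ((-1) ^ 2)).congr_coeff fun i hi => ?_
  rw [← hu]
  clear h₁ h₂
  interval_cases i <;> simp [listCoeff, convCoeff, Finset.sum_range_succ] <;> ring

lemma hasTrunc_momentTerm_three {d : ℕ} (hd : 0 < d) {h u w : ℝ} (hh : h = d + 1 / 2)
    (hu : u = (d : ℝ)⁻¹) (hw : w = ((d : ℝ) + 1)⁻¹) :
    HasTrunc (momentTerm d 3) 3 5 (listCoeff [0, 0, 0, h * u ^ 4,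
      h * (u ^ 3 - w ^ 3) / 3 - u ^ 4 * (4 * h - d * (d + 1) * h)]) := by
  have v0 := hasTrunc_moment_zero_three d hh
  have v1 := hasTrunc_moment_one_three d hh
  have v1' : InvPowO 4 (excessMoment d 1 3) := v1.invPowO
  have v2 : InvPowO 6 (excessMoment d 2 3) := invPowO_excessMoment_of_two_le d 2 (by norm_num)
  have hγ := (hasTrunc_zetaTail_four.rowSum hd (by norm_num)).add
    ((invPowO_colSum d (by norm_num : 2 ≤ 4)).hasTrunc (a := 3) (n := 1) le_rfl)
  have hD := hasTrunc_succ_ratio_four.cornerTerm d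
  have t1 := (v2.mul (invPowO_pairSum (by norm_num : 2 ≤ 4))).hasTrunc (a := 3) (n := 5)
    (by norm_num)
  have t2 := ((v1.sub (v2.hasTrunc (a := 4) (n := 1) (by norm_num))).mul hγ).shift
    (by norm_num : 3 + 4 = 7)
  have t3 := (((v0.sub ((v1'.hasTrunc (a := 2) (n := 2) le_rfl).const_mul 2)).add
    (v2.hasTrunc (a := 2) (n := 2) (by norm_num))).mul hD).shift (by norm_num : 3 + 3 = 6)
  refine (((t1.add t2).add t3).const_mul ((-1) ^ 3)).congr_coeff fun i hi => ?_
  rw [← hu, ← hw]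
  interval_cases i <;> simp [listCoeff, convCoeff, Finset.sum_range_succ] <;> ring

/-- Only the corner product reaches b^(-7). -/
lemma hasTrunc_momentTerm_four {d : ℕ} (hd : 0 < d) {h u : ℝ} (hh : h = d + 1 / 2)
    (hu : u = (d : ℝ)⁻¹) :
    HasTrunc (momentTerm d 4) 3 5 (listCoeff [0, 0, 0, 0, -(h * u ^ 5)]) := by
  have v0 := hasTrunc_moment_zero_four d hh
  have v1 : InvPowO 4 (excessMoment d 1 4) := invPowO_excessMoment_of_two_le d 1 (by norm_num)
  have v2 : InvPowO 6 (excessMoment d 2 4) := invPowO_excessMoment_of_two_le d 2 (by norm_num)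
  have hδ := (invPowO_rowSum hd (by norm_num : 2 ≤ 5)).add
    ((invPowO_colSum d (by norm_num : 2 ≤ 5)).mono (by norm_num))
  have hD := hasTrunc_succ_ratio_five.cornerTerm d
  have t1 := (v2.mul (invPowO_pairSum (by norm_num : 2 ≤ 5))).hasTrunc (a := 3) (n := 5)
    (by norm_num)
  have t2 := ((v1.sub (v2.mono (by norm_num))).mul hδ).hasTrunc (a := 3) (n := 5) (by norm_num)
  have t3 := (((v0.sub ((v1.hasTrunc (a := 2) (n := 1) (by norm_num)).const_mul 2)).add
    (v2.hasTrunc (a := 2) (n := 1) (by norm_num))).mul hD).shift (by norm_num : 3 + 4 = 7)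
  refine (((t1.add t2).add t3).const_mul ((-1) ^ 4)).congr_coeff fun i hi => ?_
  rw [← hu]
  interval_cases i <;> simp [listCoeff, convCoeff]
  ring

/-- The three products are O(b^(-6-m)), O(b^(-4-m)) and O(b^(-3-m)); the corner is the worst and
forces m ≥ 5. -/
lemma invPowO_momentTerm {d m : ℕ} (hd : 0 < d) (hm : 5 ≤ m) : InvPowO 8 (momentTerm d m) := by
  have v0 : InvPowO 2 (excessMoment d 0 m) := invPowO_excessMoment_of_two_le d 0 (by omega)
  have v1 : InvPowO 4 (excessMoment d 1 m) := invPowO_excessMoment_of_two_le d 1 (by omega)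
  have v2 : InvPowO 6 (excessMoment d 2 m) := invPowO_excessMoment_of_two_le d 2 (by omega)
  have hs : 2 ≤ m + 1 := by omega
  have t1 := (v2.mul (invPowO_pairSum hs)).mono (by omega : 8 ≤ 6 + (m + 1 - 1))
  have t2 := ((v1.sub (v2.mono (by norm_num))).mul ((invPowO_rowSum hd hs).add
    ((invPowO_colSum d hs).mono (by omega)))).mono (by omega : 8 ≤ 4 + (m + 1 - 1))
  have t3 := (((v0.sub ((v1.mono (by norm_num)).const_mul 2)).add (v2.mono (by norm_num))).mul
    (invPowO_cornerTerm d (m + 1))).mono (by omega : 8 ≤ 2 + (m + 1))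
  exact ((t1.add t2).add t3).const_mul _

/-- The first coefficients of the expansion of the Irwin sum. -/
noncomputable def irwinCoeff (d : ℕ) : List ℝ :=
  [((d : ℝ) + 1 / 2) / (d : ℝ) ^ 2,
    -(((d : ℝ) + 1 / 2) / ((d : ℝ) ^ 2 * ((d : ℝ) + 1))),
    ((d : ℝ) + 1 / 2) * zetaReal 2
        - (30 * (d : ℝ) ^ 3 + 70 * (d : ℝ) ^ 2 + 47 * (d : ℝ) + 10)
          / (12 * (d : ℝ) ^ 3 * ((d : ℝ) + 1) ^ 2),
    -((2 * (d : ℝ) + 1) * (d : ℝ) * zetaReal 3) + (2 * (d : ℝ) + 1) * zetaReal 2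
        - (12 * (d : ℝ) ^ 6 - 60 * (d : ℝ) ^ 5 - 258 * (d : ℝ) ^ 4 - 342 * (d : ℝ) ^ 3
            - 212 * (d : ℝ) ^ 2 - 61 * (d : ℝ) - 6)
          / (12 * (d : ℝ) ^ 4 * ((d : ℝ) + 1) ^ 3),
    3 * ((d : ℝ) + 1 / 2) * (d : ℝ) ^ 2 * zetaReal 4
        - ((d : ℝ) + 1 / 2) * (6 * (d : ℝ) + 1) * zetaReal 3
        - (60 * (d : ℝ) ^ 7 + 240 * (d : ℝ) ^ 6 + 440 * (d : ℝ) ^ 5 + 561 * (d : ℝ) ^ 4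
            + 465 * (d : ℝ) ^ 3 + 219 * (d : ℝ) ^ 2 + 54 * (d : ℝ) + 6)
          / (12 * (d : ℝ) ^ 5 * ((d : ℝ) + 1) ^ 3)]

lemma hasTrunc_irwinSum {d : ℕ} (hd : 0 < d) :
    HasTrunc (fun b => irwinSum b d 2 - (b : ℝ) * Real.log b) 3 5 (listCoeff (irwinCoeff d)) := by
  have m1 := hasTrunc_momentTerm_one hd rfl rfl rfl rfl rfl rfl rfl
  have m2 := hasTrunc_momentTerm_two hd rfl rfl rfl rfl rfl rfl
  have m3 := hasTrunc_momentTerm_three hd rfl rfl rfl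
  have m4 := hasTrunc_momentTerm_four hd rfl rfl
  have m5 : InvPowO 8 fun b => ∑ m ∈ Finset.Icc 5 9, momentTerm d m b :=
    InvPowO.sum fun m hm => invPowO_momentTerm hd (Finset.mem_Icc.1 hm).1
  -- Error O(b^(-8)) requires moments up to order 9; those from 5 to 9 are themselves negligible.
  have hrest := (m5.add (irwinSum_approx hd 8)).hasTrunc (a := 3) (n := 5) le_rfl
  have hd0 : (d : ℝ) ≠ 0 := by positivity
  have hd1 : (d : ℝ) + 1 ≠ 0 := by positivity
  refine (((((m1.add m2).add m3).add m4).add hrest).congr (Eventually.of_forall fun b => ?_)).congr_coeff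
    fun i hi => ?_
  · have e : Finset.Icc 1 (8 + 1) = {1, 2, 3, 4} ∪ Finset.Icc 5 9 := by decide
    have e2 : Disjoint ({1, 2, 3, 4} : Finset ℕ) (Finset.Icc 5 9) := by decide
    beta_reduce
    rw [e, Finset.sum_union e2]
    simp
    ring
  · interval_cases i <;> simp [listCoeff, irwinCoeff] <;> field_simp <;> ring

theorem mainTheorem6 (d : ℕ) (hd : 0 < d) :
    (∀ b : ℕ, d < b → Summable (fun m : irwinSet b d 2 => 1 / ((m : ℕ) : ℝ))) ∧
    ∃ a : ℕ → ℝ,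
      (∀ N : ℕ,
        (fun b : ℕ => irwinSum b d 2 - (b : ℝ) * Real.log (b : ℝ)
            - ∑ n ∈ Finset.Icc 1 N, a n / (b : ℝ) ^ (n + 2))
          =O[atTop] (fun b : ℕ => 1 / (b : ℝ) ^ (N + 3))) ∧
      a 1 = ((d : ℝ) + 1 / 2) / (d : ℝ) ^ 2 ∧
      a 2 = -(((d : ℝ) + 1 / 2) / ((d : ℝ) ^ 2 * ((d : ℝ) + 1))) ∧
      a 3 = ((d : ℝ) + 1 / 2) * zetaReal 2
        - (30 * (d : ℝ) ^ 3 + 70 * (d : ℝ) ^ 2 + 47 * (d : ℝ) + 10)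
          / (12 * (d : ℝ) ^ 3 * ((d : ℝ) + 1) ^ 2) ∧
      a 4 = -((2 * (d : ℝ) + 1) * (d : ℝ) * zetaReal 3) + (2 * (d : ℝ) + 1) * zetaReal 2
        - (12 * (d : ℝ) ^ 6 - 60 * (d : ℝ) ^ 5 - 258 * (d : ℝ) ^ 4 - 342 * (d : ℝ) ^ 3
            - 212 * (d : ℝ) ^ 2 - 61 * (d : ℝ) - 6)
          / (12 * (d : ℝ) ^ 4 * ((d : ℝ) + 1) ^ 3) ∧
      a 5 = 3 * ((d : ℝ) + 1 / 2) * (d : ℝ) ^ 2 * zetaReal 4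
        - ((d : ℝ) + 1 / 2) * (6 * (d : ℝ) + 1) * zetaReal 3
        - (60 * (d : ℝ) ^ 7 + 240 * (d : ℝ) ^ 6 + 440 * (d : ℝ) ^ 5 + 561 * (d : ℝ) ^ 4
            + 465 * (d : ℝ) ^ 3 + 219 * (d : ℝ) ^ 2 + 54 * (d : ℝ) + 6)
          / (12 * (d : ℝ) ^ 5 * ((d : ℝ) + 1) ^ 3) := by
  refine ⟨fun b hb => (hasSum_irwinSet (by omega) hb).summable, ?_⟩
  obtain ⟨c, hc⟩ := (hasInvExpansion_irwinSum hd).exists_coeff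
  have hT := (hasTrunc_irwinSum hd).shift (by norm_num : 0 + 3 = 3)
  -- Uniqueness matches the abstract coefficients with the computed ones, including the vanishing of
  -- those of 1, 1/b and 1/b^2.
  have hcoeff : ∀ i < 8, c i = if i < 3 then 0 else listCoeff (irwinCoeff d) (i - 3) := by
    intro i hi
    have h1 : InvPowO 8 fun b => irwinSum b d 2 - (b : ℝ) * Real.log b
        - (∑ i ∈ Finset.range 8, Polynomial.monomial i (c i)).eval (b : ℝ)⁻¹ := by
      simpa only [eval_sum_monomial] using hc 8
    have h2 := coeff_unique h1 (by simpa only [HasTrunc, zero_add] using hT) i hi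
    rwa [coeff_sum_monomial hi] at h2
  refine ⟨fun n => c (n + 2), fun N => ?_, hcoeff 3 (by norm_num), hcoeff 4 (by norm_num),
    hcoeff 5 (by norm_num), hcoeff 6 (by norm_num), hcoeff 7 (by norm_num)⟩
  have h : InvPowO (N + 3) fun b => irwinSum b d 2 - (b : ℝ) * Real.log b
      - ∑ n ∈ Finset.Icc 1 N, c (n + 2) / (b : ℝ) ^ (n + 2) := by
    refine (hc (N + 3)).congr (Eventually.of_forall fun b => ?_)
    simp only
    congr 1
    rw [add_comm N 3, Finset.sum_range_add, Finset.sum_eq_zero (s := Finset.range 3) fun i hi => by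
      have hi' := Finset.mem_range.1 hi
      rw [hcoeff i (by omega), if_pos hi', zero_mul], zero_add, ← Finset.Ico_add_one_right_eq_Icc,
      Finset.sum_Ico_eq_sum_range, Nat.add_sub_cancel]
    refine Finset.sum_congr rfl fun i _ => ?_
    rw [show 1 + i + 2 = 3 + i by ring, inv_pow, div_eq_mul_inv]
  simpa only [InvPowO, inv_pow, one_div] using h
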